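/- Let \(\|\cdot\|\) be any norm on \(\mathbb R^m\), with dual norm \(\|z\|_*=\sup_{\|w\|\le 1}\langle z,w\rangle\). Let \(\mathcal X\subseteq\mathbb R^n\) and \(\Xi\subseteq\mathbb R^m\) be convex and closed. Let \(\widehat w_1,\dots,\widehat w_N\in\Xi\) (\(N\ge 1\)) be data whose indices are partitioned into \(K\) nonempty clusters \(\Gamma_1,\dots,\Gamma_K\), and let \(\theta_1,\dots,\theta_K\ge 0\). Let \(\widehat{\mathbb P}_k=\frac1{|\Gamma_k|}\sum_{l\in\Gamma_k}\delta_{\widehat w_l}\), and let \(\mathcal W_k\) be the set of Borel probability measures \(\mathbb Q\) supported on \(\Xi\) with \(d_W(\mathbb Q,\widehat{\mathbb P}_k)\le\theta_k\), where \(d_W(\mathbb Q,\mathbb P)=\inf_\pi\int\|u-w\|\,d\pi(u,w)\) over all couplings \(\pi\) of \(\mathbb Q\) and \(\mathbb P\). Let \(\mathcal B=\bigl\{\sum_{k=1}^K\frac{|\Gamma_k|}{N}\mathbb Q_k:\ \mathbb Q_k\in\mathcal W_k\bigr\}\) be the weighted Minkowski sum of these balls. Let \(f:\mathbb R^n\to[-\infty,\infty]\)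 be convex on \(\mathcal X\), and let \(g(x,w)=\max_{1\le i\le I}h_i(x,w)\) with \(I\ge 1\), where each \(h_i:\mathbb R^n\times\mathbb R^m\to[-\infty,\infty]\) is proper on \(\mathcal X\times\Xi\) (nowhere \(+\infty\), not identically \(-\infty\)), convex in \(x\in\mathcal X\) for each \(w\in\Xi\), and upper semicontinuous and concave in \(w\in\Xi\) for each \(x\in\mathcal X\). Consider the problem \[ \inf_{x\in\mathcal X}J(x),\qquad J(x)=f(x)+\sup_{\mathbb Q\in\mathcal B}\mathbb E_{\mathbb Q}[g(x,w)], \tag{P} \] and the finite program in the variables \(x\in\mathbb R^n\), \(\lambda\in\mathbb R^K\), \(\alpha\in\mathbb R^N\), \(z_{l,i},v_{l,i}\in\mathbb R^m\) (\(1\le l\le N\), \(1\le i\le I\)) \[ \begin{aligned} \inf\ & f(x)+\sum_{k=1}^K\frac{|\Gamma_k|}{N}\Bigl[\lambda_k\theta_k+\sum_{l\in\Gamma_k}\frac{\alpha_l}{|\Gamma_k|}\Bigr]\\ \text{s.t. } & \alpha_l\ \ge\ [-h_i]^*(x,z_{l,i}-v_{l,i})+\sigma_\Xi(v_{l,i})-\langle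 z_{l,i},\widehat w_l\rangle\quad\text{for all } l,i,\\ & \|z_{l,i}\|_*\le\lambda_k\quad\text{for all } k,\ l\in\Gamma_k,\ i,\\ & x\in\mathcal X,\quad \lambda_k\ge 0\quad\text{for all } k, \end{aligned}\tag{R} \] where \([-h_i]^*(x,z)=\sup_{w\in\Xi}\{\langle z,w\rangle+h_i(x,w)\}\), \(\sigma_\Xi(v)=\sup_{w\in\Xi}\langle v,w\rangle\), and the convention \(\infty+(-\infty)=\infty\) is used in the objective of (P) and in the constraints of (R). Then (R) is a convex program: its objective and the constraint functions \([-h_i]^*(x,z_{l,i}-v_{l,i})+\sigma_\Xi(v_{l,i})-\langle z_{l,i},\widehat w_l\rangle-\alpha_l\) and \(\|z_{l,i}\|_*-\lambda_k\) are convex over all variables with \(x\in\mathcal X\), and its feasible set is convex. It is equivalent to (P): for every \(x\in\mathcal X\), \(J(x)\) is the infimum of the objective of (R) over the feasible points with this \(x\); the optimal values of (P) and (R) coincide; and a feasible point \((x,\lambda,\alpha,z,v)\) of (R) is optimal for (R) if and only if \(x\) is optimal for (P) and the objective of (R) at this point equals \(J(x)\). -/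

import Mathlib

open MeasureTheory
open scoped ENNReal

noncomputable section

namespace BNWDRO

/-- The space `ℝ^d` with its standard inner product `⟨z, w⟩ = inner ℝ z w`. -/
abbrev Vec (d : ℕ) : Type := EuclideanSpace ℝ (Fin d)

/-! ### Extended-real convex analysis -/

/-- Addition of extended reals with the convention `∞ + (-∞) = ∞` that is customary in
minimization problems. (Mathlib's `+` on `EReal` has `⊤ + ⊥ = ⊥`; the two agree otherwise.) -/
def upperAdd (a b : EReal) : EReal := -(-a + -b)

/-- An extended-real-valued function is convex on `s` if its epigraph over `s` is convex. -/
def EConvexOn {E : Type*} [AddCommGroup E] [Module ℝ E] (s : Set E) (F : E → EReal) : Prop :=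
  Convex ℝ {p : E × ℝ | p.1 ∈ s ∧ F p.1 ≤ (p.2 : EReal)}

/-- An extended-real-valued function is concave on `s` if its hypograph over `s` is convex. -/
def EConcaveOn {E : Type*} [AddCommGroup E] [Module ℝ E] (s : Set E) (F : E → EReal) : Prop :=
  Convex ℝ {p : E × ℝ | p.1 ∈ s ∧ (p.2 : EReal) ≤ F p.1}

/-- The support function `σ_Ξ(v) = sup_{w ∈ Ξ} ⟨v, w⟩`. -/
def supportFn {m : ℕ} (Xi : Set (Vec m)) (v : Vec m) : EReal :=
  ⨆ w ∈ Xi, ((inner ℝ v w : ℝ) : EReal)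

/-- The conjugate of `-φ` over `Ξ`: `[-φ]^*(z) = sup_{w ∈ Ξ} {⟨z, w⟩ + φ(w)}`. -/
def negConj {m : ℕ} (Xi : Set (Vec m)) (φ : Vec m → EReal) (z : Vec m) : EReal :=
  ⨆ w ∈ Xi, (((inner ℝ z w : ℝ) : EReal) + φ w)

/-- The dual norm `‖z‖_* = sup_{‖w‖ ≤ 1} ⟨z, w⟩`. -/
def dualNorm {m : ℕ} (nrm : Seminorm ℝ (Vec m)) (z : Vec m) : EReal :=
  ⨆ w ∈ {w : Vec m | nrm w ≤ 1}, ((inner ℝ z w : ℝ) : EReal)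

/-! ### The ambiguity set -/

/-- Expectation of an extended-real-valued function, `E_Q[φ] = ∫ φ⁺ dQ - ∫ φ⁻ dQ`. -/
def expect {m : ℕ} (Q : Measure (Vec m)) (φ : Vec m → EReal) : EReal :=
  ((∫⁻ w, (φ w).toENNReal ∂Q : ℝ≥0∞) : EReal) - ((∫⁻ w, (-φ w).toENNReal ∂Q : ℝ≥0∞) : EReal)

/-- The couplings of `Q` and `P`: measures with first marginal `Q` and second marginal `P`. -/
def couplings {m : ℕ} (Q P : Measure (Vec m)) : Set (Measure (Vec m × Vec m)) :=
  {π | π.map Prod.fst = Q ∧ π.map Prod.snd = P}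

/-- The Wasserstein distance for the ground metric `‖x - y‖`. -/
def wassersteinDist {m : ℕ} (nrm : Seminorm ℝ (Vec m)) (Q P : Measure (Vec m)) : ℝ≥0∞ :=
  ⨅ π ∈ couplings Q P, ∫⁻ p, ENNReal.ofReal (nrm (p.1 - p.2)) ∂π

/-- The Borel probability measures on `ℝ^m` supported on `Ξ`. -/
def probOn {m : ℕ} (Xi : Set (Vec m)) : Set (Measure (Vec m)) :=
  {Q | IsProbabilityMeasure Q ∧ Q Xiᶜ = 0}

/-- The Wasserstein ball of radius `θ` around `P` within the probability measures on `Ξ`. -/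
def wassersteinBall {m : ℕ} (nrm : Seminorm ℝ (Vec m)) (Xi : Set (Vec m)) (θ : ℝ)
    (P : Measure (Vec m)) : Set (Measure (Vec m)) :=
  {Q | Q ∈ probOn Xi ∧ wassersteinDist nrm Q P ≤ ENNReal.ofReal θ}

/-- The (indices of the) data points with cluster label `k`. -/
def cluster {N K : ℕ} (label : Fin N → Fin K) (k : Fin K) : Finset (Fin N) :=
  Finset.univ.filter fun l => label l = k

/-- The empirical distribution of the `k`-th cluster. -/
def localEmpirical {m N K : ℕ} (data : Fin N → Vec m) (label : Fin N → Fin K) (k : Fin K) :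
    Measure (Vec m) :=
  ((cluster label k).card : ℝ≥0∞)⁻¹ • ∑ l ∈ cluster label k, Measure.dirac (data l)

/-- The ambiguity set: the Minkowski sum, over the clusters `k`, of the local Wasserstein balls
scaled by the relative cluster sizes. -/
def ambiguitySet {m N K : ℕ} (nrm : Seminorm ℝ (Vec m)) (Xi : Set (Vec m))
    (data : Fin N → Vec m) (label : Fin N → Fin K) (θ : Fin K → ℝ) : Set (Measure (Vec m)) :=
  {Q | ∃ P : Fin K → Measure (Vec m),
    (∀ k, P k ∈ wassersteinBall nrm Xi (θ k) (localEmpirical data label k)) ∧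
    Q = ∑ k, (((cluster label k).card : ℝ≥0∞) / (N : ℝ≥0∞)) • P k}

/-! ### The distributionally robust problem -/

/-- The loss `g(x, w) = max_i h_i(x, w)`. -/
def maxLoss {n m I : ℕ} (h : Fin I → Vec n → Vec m → EReal) (x : Vec n) (w : Vec m) : EReal :=
  ⨆ i, h i x w

/-- The objective `f(x) + sup_{Q} E_Q[g(x, ·)]` of the distributionally robust problem, with `Q`
ranging over the ambiguity set. -/
def robustObjective {n m I N K : ℕ} (nrm : Seminorm ℝ (Vec m)) (Xi : Set (Vec m))
    (f : Vec n → EReal) (h : Fin I → Vec n → Vec m → EReal)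
    (data : Fin N → Vec m) (label : Fin N → Fin K) (θ : Fin K → ℝ) (x : Vec n) : EReal :=
  upperAdd (f x) (⨆ Q ∈ ambiguitySet nrm Xi data label θ, expect Q (maxLoss h x))

/-! ### The finite program -/

/-- The decision variables `(x, λ, α, z, v)` of the finite program. -/
abbrev Var (n m I N K : ℕ) : Type :=
  Vec n × (Fin K → ℝ) × (Fin N → ℝ) × (Fin N → Fin I → Vec m) × (Fin N → Fin I → Vec m)

section Projections

variable {n m I N K : ℕ}

/-- The decision `x`. -/
abbrev Var.x (y : Var n m I N K) : Vec n := y.1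

/-- The multipliers `λ_k`. -/
abbrev Var.lam (y : Var n m I N K) : Fin K → ℝ := y.2.1

/-- The epigraphical variables `α_l`. -/
abbrev Var.alpha (y : Var n m I N K) : Fin N → ℝ := y.2.2.1

/-- The variables `z_{l,i}`. -/
abbrev Var.z (y : Var n m I N K) : Fin N → Fin I → Vec m := y.2.2.2.1

/-- The variables `v_{l,i}`. -/
abbrev Var.v (y : Var n m I N K) : Fin N → Fin I → Vec m := y.2.2.2.2

end Projections

/-- The objective `f(x) + ∑_k |Γ_k|/N [λ_k θ_k + ∑_{l ∈ Γ_k} α_l/|Γ_k|]`. -/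
def progObjective {n m I N K : ℕ} (f : Vec n → EReal) (label : Fin N → Fin K) (θ : Fin K → ℝ)
    (y : Var n m I N K) : EReal :=
  f (Var.x y) + ((∑ k, ((cluster label k).card : ℝ) / (N : ℝ) *
    (Var.lam y k * θ k +
      ∑ l ∈ cluster label k, Var.alpha y l / ((cluster label k).card : ℝ)) : ℝ) : EReal)

/-- The constraint function
`[-h_i]^*(x, z_{l,i} - v_{l,i}) + σ_Ξ(v_{l,i}) - ⟨z_{l,i}, ŵ_l⟩ - α_l`. -/
def conjConstraint {n m I N K : ℕ} (Xi : Set (Vec m)) (h : Fin I → Vec n → Vec m → EReal)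
    (data : Fin N → Vec m) (l : Fin N) (i : Fin I) (y : Var n m I N K) : EReal :=
  upperAdd (negConj Xi (h i (Var.x y)) (Var.z y l i - Var.v y l i)) (supportFn Xi (Var.v y l i)) -
    ((inner ℝ (Var.z y l i) (data l) + Var.alpha y l : ℝ) : EReal)

/-- The constraint function `‖z_{l,i}‖_* - λ_k`, where `k` is the cluster of `l`. -/
def normConstraint {n m I N K : ℕ} (nrm : Seminorm ℝ (Vec m)) (label : Fin N → Fin K)
    (l : Fin N) (i : Fin I) (y : Var n m I N K) : EReal :=
  dualNorm nrm (Var.z y l i) - ((Var.lam y (label l) : ℝ) : EReal)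

/-- The feasible set of the finite program. -/
def progFeasible {n m I N K : ℕ} (nrm : Seminorm ℝ (Vec m)) (X : Set (Vec n)) (Xi : Set (Vec m))
    (h : Fin I → Vec n → Vec m → EReal) (data : Fin N → Vec m) (label : Fin N → Fin K) :
    Set (Var n m I N K) :=
  {y | Var.x y ∈ X ∧ (∀ k, 0 ≤ Var.lam y k) ∧
    (∀ l i, conjConstraint Xi h data l i y ≤ 0) ∧
    (∀ l i, normConstraint nrm label l i y ≤ 0)}

end BNWDRO

end

/-!
The program is convex because its constraint functions are suprema over `w` of functions jointly
convex in all the variables, and `upperAdd a b ≤ t` says precisely that the real bound `t` splits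
into a bound for `a` and one for `b`.

For the equivalence, fix `x ∈ X` and write `g` for the loss `max_i h_i(x, ·)`. Everything follows
once the worst-case expectation of `g` over the ambiguity set is identified with the infimum of the
linear part of the objective over the feasible points above `x`.

*Weak duality.* A feasible point forces `g w ≤ α_l + λ_k ‖w - ŵ_l‖` on `Ξ` for `l ∈ Γ_k`
(`maxLoss_le_of_feasible`); integrating this against a coupling bounds the expectation of `g`
(`expect_le_of_mem_wassersteinBall`). Expectations are additive over the weighted sum of the balls
because a real bound on `∫ g⁺ - ∫ g⁻` is an inequality between sums in `ℝ≥0∞`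
(`expect_sum_smul_le`, `le_expect_sum_smul`).

*Strong duality.* A bound on the worst-case expectation over a single ball is certified, up to an
arbitrarily small error, by such cone majorants (`exists_certificate`). The achievable pairs
(transport cost, expected loss) form a convex subset of the plane. If the radius exceeds the mean
distance `d` of the data to the effective domain of `g`, then Slater's condition holds and a
separating line yields the multiplier `λ`. If the radius is smaller than `d`, the dual values tend
to `-∞` as `λ → ∞`, because `g` grows at most linearly (`exists_linear_growth`). If it equals `d`,
letting `λ → ∞` also works, by upper semicontinuity and compactness
(`exists_forall_ge_multiplier`). Finally, a concave function below the cone `α + λ ‖· - ŵ‖` lies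
below an affine function `α - ⟨z, · - ŵ⟩` with `‖z‖_* ≤ λ`, by separating its hypograph from the
cone (`exists_dual_vector`); this produces the variables `z`, while `v = 0` is always a good choice.
-/

namespace BNWDRO

/-! ### Extended-real arithmetic -/

lemma upperAdd_coe (a : EReal) (r : ℝ) : upperAdd a r = a + r := by
  induction a using EReal.rec with
  | bot => simp [upperAdd]
  | top => simp [upperAdd]
  | coe a => unfold upperAdd; norm_cast; ring

lemma upperAdd_mono_right {a b c : EReal} (hbc : b ≤ c) : upperAdd a b ≤ upperAdd a c := by
  unfold upperAdd
  rw [EReal.neg_le_neg_iff]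
  exact add_le_add le_rfl (EReal.neg_le_neg_iff.mpr hbc)

lemma add_coe_le_coe_iff (a : EReal) (r t : ℝ) :
    a + (r : EReal) ≤ (t : EReal) ↔ a ≤ ((t - r : ℝ) : EReal) := by
  induction a using EReal.rec with
  | bot => simp
  | top => simp [-EReal.coe_sub]
  | coe a => norm_cast; exact le_sub_iff_add_le.symm

lemma coe_add_le_coe_iff (a : EReal) (r t : ℝ) :
    (r : EReal) + a ≤ (t : EReal) ↔ a ≤ ((t - r : ℝ) : EReal) := by
  rw [add_comm, add_coe_le_coe_iff]

lemma sub_coe_le_coe_iff (a : EReal) (r t : ℝ) :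
    a - (r : EReal) ≤ (t : EReal) ↔ a ≤ ((t + r : ℝ) : EReal) := by
  rw [sub_eq_add_neg, ← EReal.coe_neg, add_coe_le_coe_iff, sub_neg_eq_add]

lemma upperAdd_le_coe_iff (a b : EReal) (t : ℝ) :
    upperAdd a b ≤ (t : EReal) ↔ ∃ s : ℝ, a ≤ (s : EReal) ∧ b ≤ ((t - s : ℝ) : EReal) := by
  induction a using EReal.rec with
  | top => simp [upperAdd]
  | coe a =>
    have : upperAdd a b = b + a := by
      rw [← upperAdd_coe]; simp [upperAdd, add_comm]
    rw [this, add_coe_le_coe_iff]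
    constructor
    · intro h; exact ⟨a, le_rfl, h⟩
    · rintro ⟨s, hs, hb⟩
      refine hb.trans ?_
      norm_cast at hs ⊢
      linarith
  | bot =>
    induction b using EReal.rec with
    | top => simp [upperAdd, -EReal.coe_sub]
    | bot => simp [upperAdd]
    | coe b =>
      refine ⟨fun _ => ⟨t - b, bot_le, by norm_cast; linarith⟩, fun _ => ?_⟩
      rw [upperAdd_coe]; simp

/-- If the weighted sums `∑ c k * t k` over reals `t k < M k` are bounded by some `r' < r`, then
the `M k` themselves, as long as none is `⊤`, are exceeded by reals with weighted sum at most `r`.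
Values `M k = ⊥` are allowed; they make the bound vacuous and the conclusion easy. -/
lemma exists_gt_sum_le {κ : Type*} {S : Finset κ} (hS : S.Nonempty) {c : κ → ℝ}
    (hc : ∀ k ∈ S, 0 < c k) {M : κ → EReal} (hM : ∀ k ∈ S, M k ≠ ⊤) {r r' : ℝ} (hr : r' < r)
    (hle : ∀ t : κ → ℝ, (∀ k ∈ S, (t k : EReal) < M k) → ∑ k ∈ S, c k * t k ≤ r') :
    ∃ s : κ → ℝ, (∀ k ∈ S, M k < (s k : EReal)) ∧ ∑ k ∈ S, c k * s k ≤ r := by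
  classical
  by_cases hbot : ∃ j ∈ S, M j = ⊥
  · obtain ⟨j, hjS, hj⟩ := hbot
    have : ∀ k ∈ S, ∃ s : ℝ, M k < (s : EReal) := fun k hk => by
      obtain ⟨s, hs, -⟩ := EReal.lt_iff_exists_real_btwn.mp (lt_top_iff_ne_top.mpr (hM k hk))
      exact ⟨s, hs⟩
    choose! s hs using this
    -- The coordinate with `M j = ⊥` absorbs whatever the others cost.
    refine ⟨Function.update s j ((r - ∑ k ∈ S.erase j, c k * s k) / c j), ?_, ?_⟩
    · intro k hk
      by_cases hkj : k = j
      · subst hkj; rw [hj]; exact EReal.bot_lt_coe _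
      · rw [Function.update_of_ne hkj]; exact hs k hk
    · rw [← Finset.add_sum_erase _ _ hjS, Function.update_self, mul_div_cancel₀ _ (hc j hjS).ne']
      refine le_of_eq ?_
      rw [sub_add, sub_eq_self, sub_eq_zero]
      exact Finset.sum_congr rfl fun k hk => by
        rw [Function.update_of_ne (Finset.ne_of_mem_erase hk)]
  · push Not at hbot
    have hC : 0 < ∑ k ∈ S, c k := Finset.sum_pos hc hS
    have hcoe : ∀ k ∈ S, ((M k).toReal : EReal) = M k := fun k hk =>
      EReal.coe_toReal (hM k hk) (hbot k hk)
    set e := (r - r') / (2 * ∑ k ∈ S, c k) with he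
    have he0 : 0 < e := by apply div_pos <;> linarith
    have heC : e * ∑ k ∈ S, c k = (r - r') / 2 := by rw [he]; field_simp
    refine ⟨fun k => (M k).toReal + e, fun k hk => ?_, ?_⟩
    · nth_rw 1 [← hcoe k hk]
      exact EReal.coe_lt_coe (by linarith)
    have := hle (fun k => (M k).toReal - e) fun k hk => by
      nth_rw 2 [← hcoe k hk]
      exact EReal.coe_lt_coe (by linarith)
    simp only [mul_sub, mul_add, Finset.sum_sub_distrib, Finset.sum_add_distrib,
      ← Finset.sum_mul] at this ⊢
    linarith [mul_comm e (∑ k ∈ S, c k)]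

lemma ne_top_of_sum_le {κ : Type*} {S : Finset κ} {c : κ → ℝ} (hc : ∀ k ∈ S, 0 < c k)
    {M : κ → EReal} (hM : ∀ k ∈ S, M k ≠ ⊥) {r : ℝ}
    (hle : ∀ t : κ → ℝ, (∀ k ∈ S, (t k : EReal) < M k) → ∑ k ∈ S, c k * t k ≤ r) :
    ∀ k ∈ S, M k ≠ ⊤ := by
  classical
  intro j hjS hj
  have : ∀ k ∈ S, ∃ t : ℝ, (t : EReal) < M k := fun k hk => by
    obtain ⟨t, -, ht⟩ := EReal.lt_iff_exists_real_btwn.mp (bot_lt_iff_ne_bot.mpr (hM k hk))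
    exact ⟨t, ht⟩
  choose! t ht using this
  have := hle (Function.update t j ((r + 1 - ∑ k ∈ S.erase j, c k * t k) / c j)) fun k hk => by
    by_cases hkj : k = j
    · subst hkj; rw [hj]; exact EReal.coe_lt_top _
    · rw [Function.update_of_ne hkj]; exact ht k hk
  rw [← Finset.add_sum_erase _ _ hjS, Function.update_self, mul_div_cancel₀ _ (hc j hjS).ne',
    sub_add, sub_le_iff_le_add] at this
  have heq : ∑ k ∈ S.erase j, c k * t k = ∑ k ∈ S.erase j, c k * Function.update t j
      ((r + 1 - ∑ k ∈ S.erase j, c k * t k) / c j) k :=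
    Finset.sum_congr rfl fun k hk => by
      rw [Function.update_of_ne (Finset.ne_of_mem_erase hk)]
  linarith

/-! ### Convexity of the finite program -/

lemma progObjective_convexOn {n m I N K : ℕ} {X : Set (Vec n)} {f : Vec n → EReal}
    (hf : EConvexOn X f) (label : Fin N → Fin K) (θ : Fin K → ℝ) :
    EConvexOn {y : Var n m I N K | Var.x y ∈ X} (progObjective f label θ) := by
  rintro ⟨⟨x, lam, al, z, v⟩, s⟩ ⟨hx, hs⟩ ⟨⟨x', lam', al', z', v'⟩, s'⟩ ⟨hx', hs'⟩ a b ha hb hab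
  simp only [Set.mem_ofPred_eq, progObjective, add_coe_le_coe_iff] at hx hx' hs hs' ⊢
  have := hf (x := (x, _)) ⟨hx, hs⟩ (y := (x', _)) ⟨hx', hs'⟩ ha hb hab
  refine ⟨this.1, this.2.trans (le_of_eq ?_)⟩
  simp only [Prod.smul_mk, smul_eq_mul, Prod.mk_add_mk, EReal.coe_eq_coe_iff]
  rw [mul_sub, mul_sub, ← add_sub_add_comm, Finset.mul_sum, Finset.mul_sum,
    ← Finset.sum_add_distrib]
  congr 1
  refine Finset.sum_congr rfl fun k _ => ?_
  simp only [Var.lam, Var.alpha, Pi.add_apply, Pi.smul_apply, smul_eq_mul]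
  simp only [mul_add, Finset.mul_sum, add_div, Finset.sum_add_distrib]
  have (c : ℝ) (w : Fin N → ℝ) : ∑ l ∈ cluster label k, (c : ℝ) * w l / ((cluster label k).card : ℝ)
      = ∑ l ∈ cluster label k, c * (w l / ((cluster label k).card : ℝ)) := by
    simp only [mul_div_assoc]
  simp only [this, ← Finset.mul_sum]
  ring

/-- A bound on the constraint function amounts to affine bounds, indexed by `w ∈ Ξ`, on the values
`h i x w` and on `⟨v, w⟩`, with a free real `s` splitting the right-hand side. -/
lemma conjConstraint_le_iff {n m I N K : ℕ} {Xi : Set (Vec m)} {h : Fin I → Vec n → Vec m → EReal}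
    {data : Fin N → Vec m} {l : Fin N} {i : Fin I} {y : Var n m I N K} {t : ℝ} :
    conjConstraint Xi h data l i y ≤ (t : EReal) ↔
      ∃ s : ℝ, (∀ w ∈ Xi, h i (Var.x y) w ≤
          ((s - inner ℝ (Var.z y l i - Var.v y l i) w : ℝ) : EReal)) ∧
        ∀ w ∈ Xi, inner ℝ (Var.v y l i) w ≤
          t + (inner ℝ (Var.z y l i) (data l) + Var.alpha y l) - s := by
  simp only [conjConstraint, sub_coe_le_coe_iff, upperAdd_le_coe_iff, negConj, supportFn,
    iSup_le_iff, coe_add_le_coe_iff, EReal.coe_le_coe_iff]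

lemma conjConstraint_convexOn {n m I N K : ℕ} {X : Set (Vec n)} {Xi : Set (Vec m)}
    {h : Fin I → Vec n → Vec m → EReal} {i : Fin I}
    (hX : Convex ℝ X) (hconvex : ∀ w ∈ Xi, EConvexOn X (fun x => h i x w))
    (data : Fin N → Vec m) (l : Fin N) :
    EConvexOn {y : Var n m I N K | Var.x y ∈ X} (conjConstraint Xi h data l i) := by
  rintro ⟨⟨x, lam, al, z, v⟩, t⟩ ⟨hx, ht⟩ ⟨⟨x', lam', al', z', v'⟩, t'⟩ ⟨hx', ht'⟩ a b ha hb hab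
  simp only [Set.mem_ofPred_eq, conjConstraint_le_iff] at hx hx' ht ht' ⊢
  obtain ⟨s, hs, hv⟩ := ht
  obtain ⟨s', hs', hv'⟩ := ht'
  have key : ∀ w ∈ Xi, _ := fun w hw =>
    hconvex w hw (x := (x, _)) ⟨hx, hs w hw⟩ (y := (x', _)) ⟨hx', hs' w hw⟩ ha hb hab
  refine ⟨hX hx hx' ha hb hab, a * s + b * s', fun w hw => (key w hw).2.trans (le_of_eq ?_), fun w hw => ?_⟩
  · simp only [Prod.smul_mk, Prod.mk_add_mk, Var.z, Var.v, Pi.add_apply, Pi.smul_apply,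
      smul_eq_mul, inner_sub_left, inner_add_left, real_inner_smul_left, EReal.coe_eq_coe_iff]
    ring
  · have h1 := mul_le_mul_of_nonneg_left (hv w hw) ha
    have h2 := mul_le_mul_of_nonneg_left (hv' w hw) hb
    simp only [Prod.smul_mk, Prod.mk_add_mk, Var.z, Var.v, Var.alpha, Pi.add_apply, Pi.smul_apply,
      smul_eq_mul, inner_add_left, real_inner_smul_left] at h1 h2 ⊢
    linarith

lemma normConstraint_le_iff {n m I N K : ℕ} {nrm : Seminorm ℝ (Vec m)} {label : Fin N → Fin K}
    {l : Fin N} {i : Fin I} {y : Var n m I N K} {t : ℝ} :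
    normConstraint nrm label l i y ≤ (t : EReal) ↔
      ∀ w, nrm w ≤ 1 → inner ℝ (Var.z y l i) w ≤ t + Var.lam y (label l) := by
  simp only [normConstraint, sub_coe_le_coe_iff, dualNorm, iSup_le_iff, EReal.coe_le_coe_iff,
    Set.mem_ofPred_eq]

lemma normConstraint_convexOn {n m I N K : ℕ} {X : Set (Vec n)} (hX : Convex ℝ X)
    (nrm : Seminorm ℝ (Vec m)) (label : Fin N → Fin K) (l : Fin N) (i : Fin I) :
    EConvexOn {y : Var n m I N K | Var.x y ∈ X} (normConstraint nrm label l i) := by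
  rintro ⟨⟨x, lam, al, z, v⟩, t⟩ ⟨hx, ht⟩ ⟨⟨x', lam', al', z', v'⟩, t'⟩ ⟨hx', ht'⟩ a b ha hb hab
  simp only [Set.mem_ofPred_eq, normConstraint_le_iff] at hx hx' ht ht' ⊢
  refine ⟨hX hx hx' ha hb hab, fun w hw => ?_⟩
  have h1 := mul_le_mul_of_nonneg_left (ht w hw) ha
  have h2 := mul_le_mul_of_nonneg_left (ht' w hw) hb
  simp only [Prod.smul_mk, Prod.mk_add_mk, Var.z, Var.lam, Pi.add_apply, Pi.smul_apply,
    smul_eq_mul, inner_add_left, real_inner_smul_left] at h1 h2 ⊢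
  linarith

lemma EConvexOn.convex_sublevel {E : Type*} [AddCommGroup E] [Module ℝ E] {s : Set E}
    {F : E → EReal} (hF : EConvexOn s F) : Convex ℝ {y | y ∈ s ∧ F y ≤ 0} := by
  intro y hy y' hy' a b ha hb hab
  have := hF (x := (y, 0)) ⟨hy.1, by simpa using hy.2⟩ (y := (y', 0))
    ⟨hy'.1, by simpa using hy'.2⟩ ha hb hab
  exact ⟨this.1, by simpa using this.2⟩

lemma progFeasible_convex {n m I N K : ℕ} {X : Set (Vec n)} (hX : Convex ℝ X) {Xi : Set (Vec m)}
    {h : Fin I → Vec n → Vec m → EReal}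
    (hconvex : ∀ i, ∀ w ∈ Xi, EConvexOn X (fun x => h i x w))
    (nrm : Seminorm ℝ (Vec m)) (data : Fin N → Vec m) (label : Fin N → Fin K) :
    Convex ℝ (progFeasible nrm X Xi h data label) := by
  intro y hy y' hy' a b ha hb hab
  refine ⟨hX hy.1 hy'.1 ha hb hab, fun k => ?_, fun l i => ?_, fun l i => ?_⟩
  · exact add_nonneg (mul_nonneg ha (hy.2.1 k)) (mul_nonneg hb (hy'.2.1 k))
  · exact ((conjConstraint_convexOn hX (hconvex i) data l).convex_sublevel
      ⟨hy.1, hy.2.2.1 l i⟩ ⟨hy'.1, hy'.2.2.1 l i⟩ ha hb hab).2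
  · exact ((normConstraint_convexOn hX nrm label l i).convex_sublevel
      ⟨hy.1, hy.2.2.2 l i⟩ ⟨hy'.1, hy'.2.2.2 l i⟩ ha hb hab).2

/-! ### Expectations of extended-real-valued functions -/

lemma sub_le_coe_sub_iff {A B : ℝ≥0∞} {p q : NNReal} :
    (A : EReal) - (B : EReal) ≤ (((p : ℝ) - q : ℝ) : EReal) ↔ A + q ≤ B + p := by
  induction B with
  | top => simp
  | coe B =>
    induction A with
    | top =>
      simp [← ENNReal.coe_add, -EReal.coe_sub]
    | coe A =>
      norm_cast
      rw [EReal.coe_nnreal_eq_coe_real, EReal.coe_nnreal_eq_coe_real, ← EReal.coe_sub,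
        EReal.coe_le_coe_iff, ← NNReal.coe_le_coe]
      push_cast
      constructor <;> intro h <;> linarith

lemma coe_sub_le_sub_iff {A B : ℝ≥0∞} {p q : NNReal} :
    (((p : ℝ) - q : ℝ) : EReal) ≤ (A : EReal) - (B : EReal) ↔ B ≠ ⊤ ∧ p + B ≤ A + q := by
  induction B with
  | top => simp [-EReal.coe_sub]
  | coe B =>
    induction A with
    | top =>
      simp [-EReal.coe_sub, EReal.coe_nnreal_eq_coe_real]
    | coe A =>
      norm_cast
      rw [EReal.coe_nnreal_eq_coe_real, EReal.coe_nnreal_eq_coe_real, ← EReal.coe_sub,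
        EReal.coe_le_coe_iff, ← NNReal.coe_le_coe]
      push_cast
      simp only [ENNReal.coe_ne_top, not_false_eq_true, true_and]
      constructor <;> intro h <;> linarith

lemma exists_nnreal_sub (r : ℝ) : ∃ p q : NNReal, r = p - q :=
  ⟨r.toNNReal, (-r).toNNReal, by
    rw [Real.coe_toNNReal', Real.coe_toNNReal']
    rcases le_total r 0 with h | h
    · rw [max_eq_right h, max_eq_left (by linarith)]; ring
    · rw [max_eq_left h, max_eq_right (by linarith)]; ring⟩

lemma lintegral_sum_smul {m : ℕ} {κ : Type*} (s : Finset κ) (c : κ → NNReal)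
    (P : κ → Measure (Vec m)) (F : Vec m → ℝ≥0∞) :
    ∫⁻ w, F w ∂(∑ k ∈ s, (c k : ℝ≥0∞) • P k) = ∑ k ∈ s, (c k : ℝ≥0∞) * ∫⁻ w, F w ∂(P k) := by
  rw [lintegral_finsetSum_measure]
  simp only [lintegral_smul_measure, smul_eq_mul]

lemma expect_sum_smul_le {m : ℕ} {κ : Type*} {s : Finset κ} {c : κ → NNReal}
    {P : κ → Measure (Vec m)} {φ : Vec m → EReal} {ρ : κ → ℝ}
    (hle : ∀ k ∈ s, expect (P k) φ ≤ ρ k) :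
    expect (∑ k ∈ s, (c k : ℝ≥0∞) • P k) φ ≤ ((∑ k ∈ s, c k * ρ k : ℝ) : EReal) := by
  choose p q hpq using fun k => exists_nnreal_sub (ρ k)
  have h : (∑ k ∈ s, c k * ρ k : ℝ) =
      ((∑ k ∈ s, c k * p k : NNReal) : ℝ) - ((∑ k ∈ s, c k * q k : NNReal) : ℝ) := by
    push_cast
    rw [← Finset.sum_sub_distrib]
    exact Finset.sum_congr rfl fun k _ => by rw [hpq k]; ring
  rw [h, expect, sub_le_coe_sub_iff, lintegral_sum_smul, lintegral_sum_smul]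
  push_cast
  rw [← Finset.sum_add_distrib, ← Finset.sum_add_distrib]
  refine Finset.sum_le_sum fun k hk => ?_
  have := hle k hk
  rw [hpq k, expect, sub_le_coe_sub_iff] at this
  rw [← mul_add, ← mul_add]
  gcongr

lemma le_expect_sum_smul {m : ℕ} {κ : Type*} {s : Finset κ} {c : κ → NNReal}
    {P : κ → Measure (Vec m)} {φ : Vec m → EReal} {ρ : κ → ℝ}
    (hle : ∀ k ∈ s, (ρ k : EReal) ≤ expect (P k) φ) :
    ((∑ k ∈ s, c k * ρ k : ℝ) : EReal) ≤ expect (∑ k ∈ s, (c k : ℝ≥0∞) • P k) φ := by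
  choose p q hpq using fun k => exists_nnreal_sub (ρ k)
  have h : (∑ k ∈ s, c k * ρ k : ℝ) =
      ((∑ k ∈ s, c k * p k : NNReal) : ℝ) - ((∑ k ∈ s, c k * q k : NNReal) : ℝ) := by
    push_cast
    rw [← Finset.sum_sub_distrib]
    exact Finset.sum_congr rfl fun k _ => by rw [hpq k]; ring
  have key : ∀ k ∈ s, _ := fun k hk => by
    have := hle k hk
    rwa [hpq k, expect, coe_sub_le_sub_iff] at this
  rw [h, expect, coe_sub_le_sub_iff, lintegral_sum_smul, lintegral_sum_smul]
  refine ⟨?_, ?_⟩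
  · exact ENNReal.sum_ne_top.mpr fun k hk => ENNReal.mul_ne_top ENNReal.coe_ne_top (key k hk).1
  · push_cast
    rw [← Finset.sum_add_distrib, ← Finset.sum_add_distrib]
    refine Finset.sum_le_sum fun k hk => ?_
    rw [← mul_add, ← mul_add]
    have := (key k hk).2
    gcongr

lemma expect_dirac {m : ℕ} (w : Vec m) (φ : Vec m → EReal) :
    expect (Measure.dirac w) φ = φ w := by
  rw [expect, lintegral_dirac, lintegral_dirac]
  induction φ w using EReal.rec with
  | bot => simp
  | top => simp
  | coe a =>
    rw [← EReal.coe_neg, EReal.real_coe_toENNReal, EReal.real_coe_toENNReal,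
      EReal.coe_ennreal_ofReal, EReal.coe_ennreal_ofReal]
    norm_cast
    rcases le_total a 0 with h | h
    · rw [max_eq_right h, max_eq_left (by linarith)]; ring
    · rw [max_eq_left h, max_eq_right (by linarith)]; ring

/-- An upper semicontinuous function on a closed set is almost everywhere measurable for measures
concentrated on that set, whatever its values elsewhere. -/
lemma aemeasurable_of_upperSemicontinuousOn {m : ℕ} {Xi : Set (Vec m)} (hXi : IsClosed Xi)
    {φ : Vec m → EReal} (hφ : UpperSemicontinuousOn φ Xi) {Q : Measure (Vec m)}
    (hQ : Q Xiᶜ = 0) : AEMeasurable φ Q := by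
  classical
  have husc : UpperSemicontinuous (fun w => if w ∈ Xi then φ w else ⊥) := by
    intro w y hy
    by_cases hw : w ∈ Xi
    · simp only [hw, if_true] at hy
      have := hφ w hw y hy
      rw [eventually_nhdsWithin_iff] at this
      filter_upwards [this] with w' hw'
      split_ifs with h
      · exact hw' h
      · exact bot_le.trans_lt hy
    · simp only [hw, if_false] at hy
      filter_upwards [hXi.isOpen_compl.mem_nhds hw] with w' hw'
      simpa [show w' ∉ Xi from hw'] using hy
  refine ⟨_, husc.measurable, ?_⟩
  have : ∀ᵐ w ∂Q, w ∈ Xi := hQ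
  filter_upwards [this] with w hw
  simp [hw]

/-! ### Empirical distributions and transport plans -/

/-- The uniform distribution on the points `data l`, `l ∈ Γ`, counted with multiplicity. -/
noncomputable def empirical {m : ℕ} {ι : Type*} (Γ : Finset ι) (data : ι → Vec m) :
    Measure (Vec m) :=
  ((Γ.card : ℝ≥0∞))⁻¹ • ∑ l ∈ Γ, Measure.dirac (data l)

lemma card_inv_coe {ι : Type*} {Γ : Finset ι} (hΓ : Γ.Nonempty) :
    ((Γ.card : ℝ≥0∞))⁻¹ = (((Γ.card : NNReal)⁻¹ : NNReal) : ℝ≥0∞) := by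
  rw [ENNReal.coe_inv (by simpa using hΓ.ne_empty), ENNReal.coe_natCast]

lemma empirical_eq_sum {m : ℕ} {ι : Type*} {Γ : Finset ι} (hΓ : Γ.Nonempty) (data : ι → Vec m) :
    empirical Γ data =
      ∑ l ∈ Γ, (((Γ.card : NNReal)⁻¹ : NNReal) : ℝ≥0∞) • Measure.dirac (data l) := by
  rw [empirical, card_inv_coe hΓ, Finset.smul_sum]

lemma lintegral_empirical {m : ℕ} {ι : Type*} {Γ : Finset ι} (hΓ : Γ.Nonempty) (data : ι → Vec m)
    (F : Vec m → ℝ≥0∞) :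
    ∫⁻ w, F w ∂(empirical Γ data) =
      ∑ l ∈ Γ, (((Γ.card : NNReal)⁻¹ : NNReal) : ℝ≥0∞) * F (data l) := by
  rw [empirical_eq_sum hΓ, lintegral_sum_smul Γ (fun _ => (Γ.card : NNReal)⁻¹)]
  simp

lemma empirical_univ {m : ℕ} {ι : Type*} {Γ : Finset ι} (hΓ : Γ.Nonempty) (data : ι → Vec m) :
    empirical Γ data Set.univ = 1 := by
  have : (Γ.card : ℝ≥0∞) ≠ 0 := by simpa using hΓ.ne_empty
  simp [empirical, ENNReal.inv_mul_cancel this (ENNReal.natCast_ne_top _)]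

lemma empirical_compl {m : ℕ} {ι : Type*} {Γ : Finset ι} {data : ι → Vec m} {S : Set (Vec m)}
    (hS : ∀ l ∈ Γ, data l ∈ S) : empirical Γ data Sᶜ = 0 := by
  simp only [empirical, Measure.smul_apply, Measure.finsetSum_apply, smul_eq_mul, mul_eq_zero,
    Finset.sum_eq_zero_iff]
  right
  intro l hl
  simp [hS l hl]

lemma aemeasurable_empirical {m : ℕ} {ι β : Type*} [MeasurableSpace β] [Nonempty β]
    (Γ : Finset ι) (data : ι → Vec m) (F : Vec m → β) : AEMeasurable F (empirical Γ data) := by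
  classical
  refine AEMeasurable.smul_measure ?_ _
  induction Γ using Finset.induction_on with
  | empty => simp
  | insert l s hl ih =>
    rw [Finset.sum_insert hl]
    exact aemeasurable_dirac.add_measure ih

lemma pos_part_add_le {e : EReal} {a c : ℝ} (hc : 0 ≤ c) (he : e ≤ ((a + c : ℝ) : EReal)) :
    e.toENNReal + ENNReal.ofReal (-a) ≤
      (-e).toENNReal + ENNReal.ofReal a + ENNReal.ofReal c := by
  induction e using EReal.rec with
  | bot => simp
  | top => simp [-EReal.coe_add] at he
  | coe e =>
    rw [← EReal.coe_neg, EReal.real_coe_toENNReal, EReal.real_coe_toENNReal]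
    simp only [ENNReal.ofReal]
    norm_cast at he ⊢
    rw [← NNReal.coe_le_coe]
    push_cast
    rw [Real.coe_toNNReal c hc]
    rcases le_total a 0 with h | h <;> rcases le_total e 0 with h' | h' <;>
      simp [h, h'] <;> linarith

/-- Integrating the affine bound `φ w ≤ α l + λ ‖w - ŵ_l‖` against a coupling with the empirical
distribution. -/
lemma expect_le_of_coupling {m : ℕ} {ι : Type*} {nrm : Seminorm ℝ (Vec m)}
    (hcont : Continuous nrm) {Xi : Set (Vec m)} (hXi : IsClosed Xi) {φ : Vec m → EReal}
    (hφ : UpperSemicontinuousOn φ Xi) {Γ : Finset ι} (hΓ : Γ.Nonempty) {data : ι → Vec m}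
    {lam c : ℝ} (hlam : 0 ≤ lam) (hc : 0 ≤ c) {α : ι → ℝ}
    (hα : ∀ l ∈ Γ, ∀ w ∈ Xi, φ w ≤ ((α l + lam * nrm (w - data l) : ℝ) : EReal))
    {Q : Measure (Vec m)} (hQ : Q Xiᶜ = 0) {π : Measure (Vec m × Vec m)}
    (hπ : π ∈ couplings Q (empirical Γ data))
    (hcost : ∫⁻ p, ENNReal.ofReal (nrm (p.1 - p.2)) ∂π ≤ ENNReal.ofReal c) :
    expect Q φ ≤ ((lam * c + ∑ l ∈ Γ, α l / (Γ.card : ℝ) : ℝ) : EReal) := by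
  -- Data points may coincide, so the bound at a point of the support uses the least `α l` there.
  set a : Vec m → ℝ := fun w => sInf (α '' {l | l ∈ Γ ∧ data l = w}) with ha
  have hfin : ∀ w, (α '' {l | l ∈ Γ ∧ data l = w}).Finite := fun w =>
    (Γ.finite_toSet.subset fun l hl => hl.1).image _
  have ha_le : ∀ l ∈ Γ, a (data l) ≤ α l := fun l hl =>
    csInf_le (hfin _).bddBelow ⟨l, ⟨hl, rfl⟩, rfl⟩
  have ha_bd : ∀ l ∈ Γ, ∀ w ∈ Xi,
      φ w ≤ ((a (data l) + lam * nrm (w - data l) : ℝ) : EReal) := by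
    intro l hl w hw
    obtain ⟨l', ⟨hl', hd⟩, hl'a⟩ := Set.Nonempty.csInf_mem
      (⟨_, l, ⟨hl, rfl⟩, rfl⟩ : (α '' {l' | l' ∈ Γ ∧ data l' = data l}).Nonempty) (hfin _)
    have := hα l' hl' w hw
    rwa [hd, hl'a] at this
  have hae := aemeasurable_of_upperSemicontinuousOn hXi hφ hQ
  obtain ⟨rfl, hsnd⟩ := hπ
  have h1 : ∀ᵐ p ∂π, p.1 ∈ Xi := by
    refine ae_of_ae_map (p := fun w => w ∈ Xi) measurable_fst.aemeasurable ?_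
    exact hQ
  have h2 : ∀ᵐ p ∂π, ∃ l ∈ Γ, data l = p.2 := by
    refine ae_of_ae_map (p := fun w => ∃ l ∈ Γ, data l = w) measurable_snd.aemeasurable ?_
    rw [hsnd, ae_iff]
    exact empirical_compl (S := {w | ∃ l ∈ Γ, data l = w}) fun l hl => ⟨l, hl, rfl⟩
  have hA : AEMeasurable (fun w => (φ w).toENNReal) (π.map Prod.fst) := hae.ereal_toENNReal
  have hB : AEMeasurable (fun w => (-φ w).toENNReal) (π.map Prod.fst) :=
    (measurable_neg.comp_aemeasurable hae).ereal_toENNReal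
  have hint : ∫⁻ p, ((φ p.1).toENNReal + ENNReal.ofReal (-a p.2)) ∂π ≤
      ∫⁻ p, ((-φ p.1).toENNReal + ENNReal.ofReal (a p.2) +
        ENNReal.ofReal (lam * nrm (p.1 - p.2))) ∂π := by
    refine lintegral_mono_ae ?_
    filter_upwards [h1, h2] with p hp1 hp2
    obtain ⟨l, hl, hlp⟩ := hp2
    refine pos_part_add_le (mul_nonneg hlam (apply_nonneg _ _)) ?_
    rw [← hlp]
    exact ha_bd l hl _ hp1
  have hmeas : Measurable fun p : Vec m × Vec m => ENNReal.ofReal (lam * nrm (p.1 - p.2)) := by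
    have : Continuous fun p : Vec m × Vec m => lam * nrm (p.1 - p.2) := by fun_prop
    exact this.measurable.ennreal_ofReal
  have hlamint : ∫⁻ p, ENNReal.ofReal (lam * nrm (p.1 - p.2)) ∂π ≤ ENNReal.ofReal (lam * c) := by
    simp only [ENNReal.ofReal_mul hlam]
    rw [lintegral_const_mul' _ _ ENNReal.ofReal_ne_top]
    gcongr
  have hsndint : ∀ F : Vec m → ℝ≥0∞, ∫⁻ p, F p.2 ∂π = ∫⁻ w, F w ∂(empirical Γ data) := by
    intro F
    rw [← hsnd, lintegral_map' (by rw [hsnd]; exact aemeasurable_empirical _ _ _)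
      measurable_snd.aemeasurable]
  rw [lintegral_add_left' (f := fun p : Vec m × Vec m => (φ p.1).toENNReal)
      (hA.comp_aemeasurable measurable_fst.aemeasurable),
    lintegral_add_right _ hmeas,
    lintegral_add_left' (f := fun p : Vec m × Vec m => (-φ p.1).toENNReal)
      (hB.comp_aemeasurable measurable_fst.aemeasurable),
    hsndint (fun w => ENNReal.ofReal (-a w)), hsndint (fun w => ENNReal.ofReal (a w)),
    ← lintegral_map' hA measurable_fst.aemeasurable,
    ← lintegral_map' hB measurable_fst.aemeasurable,
    lintegral_empirical hΓ, lintegral_empirical hΓ] at hint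
  have hle : expect (π.map Prod.fst) φ ≤
      ((lam * c + ∑ l ∈ Γ, a (data l) / (Γ.card : ℝ) : ℝ) : EReal) := by
    have heq : lam * c + ∑ l ∈ Γ, a (data l) / (Γ.card : ℝ) =
        ((∑ l ∈ Γ, (Γ.card : NNReal)⁻¹ * (a (data l)).toNNReal + (lam * c).toNNReal : NNReal) : ℝ)
          - ((∑ l ∈ Γ, (Γ.card : NNReal)⁻¹ * (-a (data l)).toNNReal : NNReal) : ℝ) := by
      push_cast
      rw [Real.coe_toNNReal _ (mul_nonneg hlam hc), add_comm, add_sub_right_comm,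
        ← Finset.sum_sub_distrib]
      congr 1
      refine Finset.sum_congr rfl fun l _ => ?_
      rw [← mul_sub, div_eq_inv_mul]
      congr 1
      rcases le_total (a (data l)) 0 with h | h <;> simp [h]
    rw [heq, expect, sub_le_coe_sub_iff]
    push_cast
    refine hint.trans ?_
    rw [← add_assoc]
    exact add_le_add le_rfl hlamint
  refine hle.trans (EReal.coe_le_coe_iff.mpr ?_)
  gcongr with l hl
  exact ha_le l hl

/-- Weak duality for one Wasserstein ball. -/
lemma expect_le_of_mem_wassersteinBall {m : ℕ} {ι : Type*} {nrm : Seminorm ℝ (Vec m)}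
    (hcont : Continuous nrm) {Xi : Set (Vec m)} (hXi : IsClosed Xi) {φ : Vec m → EReal}
    (hφ : UpperSemicontinuousOn φ Xi) {Γ : Finset ι} (hΓ : Γ.Nonempty) {data : ι → Vec m}
    {lam θ : ℝ} (hlam : 0 ≤ lam) (hθ : 0 ≤ θ) {α : ι → ℝ}
    (hα : ∀ l ∈ Γ, ∀ w ∈ Xi, φ w ≤ ((α l + lam * nrm (w - data l) : ℝ) : EReal))
    {Q : Measure (Vec m)} (hQ : Q ∈ wassersteinBall nrm Xi θ (empirical Γ data)) :
    expect Q φ ≤ ((lam * θ + ∑ l ∈ Γ, α l / (Γ.card : ℝ) : ℝ) : EReal) := by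
  -- The infimum over couplings need not be attained, hence the slack `δ`.
  refine EReal.le_of_forall_lt_iff_le.mp fun z hz => ?_
  rw [EReal.coe_lt_coe_iff] at hz
  set δ := (z - (lam * θ + ∑ l ∈ Γ, α l / (Γ.card : ℝ))) / (lam + 1) with hδ
  have hδ0 : 0 < δ := div_pos (by linarith) (by linarith)
  have hδl : lam * δ ≤ z - (lam * θ + ∑ l ∈ Γ, α l / (Γ.card : ℝ)) := by
    have : (lam + 1) * δ = z - (lam * θ + ∑ l ∈ Γ, α l / (Γ.card : ℝ)) := by
      rw [hδ]; field_simp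
    linarith
  have hlt : wassersteinDist nrm Q (empirical Γ data) < ENNReal.ofReal (θ + δ) :=
    hQ.2.trans_lt ((ENNReal.ofReal_lt_ofReal_iff (by linarith)).mpr (by linarith))
  simp only [wassersteinDist, iInf_lt_iff] at hlt
  obtain ⟨π, hπ, hlt⟩ := hlt
  refine (expect_le_of_coupling hcont hXi hφ hΓ hlam (by linarith : 0 ≤ θ + δ) hα hQ.1.2 hπ
    hlt.le).trans (EReal.coe_le_coe_iff.mpr ?_)
  linarith

/-- The pairs `(c, ρ)` such that some transport plan from the empirical distribution to a
probability measure on `Ξ` costs at most `c` and earns an expectation of at least `ρ`. -/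
def achievable {m : ℕ} {ι : Type*} (nrm : Seminorm ℝ (Vec m)) (Xi : Set (Vec m))
    (φ : Vec m → EReal) (Γ : Finset ι) (data : ι → Vec m) : Set (ℝ × ℝ) :=
  {p | 0 ≤ p.1 ∧ ∃ Q ∈ probOn Xi, (p.2 : EReal) ≤ expect Q φ ∧
    ∃ π ∈ couplings Q (empirical Γ data),
      ∫⁻ q, ENNReal.ofReal (nrm (q.1 - q.2)) ∂π ≤ ENNReal.ofReal p.1}

lemma exists_mem_ball_of_achievable {m : ℕ} {ι : Type*} {nrm : Seminorm ℝ (Vec m)}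
    {Xi : Set (Vec m)} {φ : Vec m → EReal} {Γ : Finset ι} {data : ι → Vec m} {c ρ θ : ℝ}
    (hp : (c, ρ) ∈ achievable nrm Xi φ Γ data) (hc : c ≤ θ) :
    ∃ Q ∈ wassersteinBall nrm Xi θ (empirical Γ data), (ρ : EReal) ≤ expect Q φ := by
  obtain ⟨-, Q, hQ, hρ, π, hπ, hcost⟩ := hp
  refine ⟨Q, ⟨hQ, ?_⟩, hρ⟩
  exact (iInf₂_le π hπ).trans (hcost.trans (ENNReal.ofReal_le_ofReal hc))

lemma achievable_convex {m : ℕ} {ι : Type*} (nrm : Seminorm ℝ (Vec m)) (Xi : Set (Vec m))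
    (φ : Vec m → EReal) (Γ : Finset ι) (data : ι → Vec m) :
    Convex ℝ (achievable nrm Xi φ Γ data) := by
  rintro ⟨c₁, ρ₁⟩ ⟨hc₁, Q₁, hQ₁, hρ₁, π₁, hπ₁, hcost₁⟩ ⟨c₂, ρ₂⟩ ⟨hc₂, Q₂, hQ₂, hρ₂, π₂, hπ₂, hcost₂⟩
    a b ha hb hab
  lift a to NNReal using ha
  lift b to NNReal using hb
  have hab' : (a : ℝ≥0∞) + b = 1 := by exact_mod_cast hab
  have := hQ₁.1
  have := hQ₂.1
  refine ⟨?_, (a : ℝ≥0∞) • Q₁ + (b : ℝ≥0∞) • Q₂, ⟨⟨?_⟩, ?_⟩, ?_,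
    (a : ℝ≥0∞) • π₁ + (b : ℝ≥0∞) • π₂, ⟨?_, ?_⟩, ?_⟩
  · exact add_nonneg (mul_nonneg a.coe_nonneg hc₁) (mul_nonneg b.coe_nonneg hc₂)
  · simp [hab']
  · simp [hQ₁.2, hQ₂.2]
  · have := le_expect_sum_smul (s := Finset.univ) (c := ![a, b]) (P := ![Q₁, Q₂]) (φ := φ)
      (ρ := ![ρ₁, ρ₂]) (by intro k _; fin_cases k <;> assumption)
    simpa [Fin.sum_univ_two] using this
  · rw [Measure.map_add _ _ measurable_fst, Measure.map_smul, Measure.map_smul, hπ₁.1, hπ₂.1]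
  · rw [Measure.map_add _ _ measurable_snd, Measure.map_smul, Measure.map_smul, hπ₁.2, hπ₂.2,
      ← add_smul, hab', one_smul]
  · rw [lintegral_add_measure, lintegral_smul_measure, lintegral_smul_measure]
    simp only [Prod.smul_mk, Prod.mk_add_mk, smul_eq_mul]
    simp only at hc₁ hc₂ hcost₁ hcost₂
    change _ ≤ ENNReal.ofReal ((a : ℝ) * c₁ + (b : ℝ) * c₂)
    rw [ENNReal.ofReal_add (mul_nonneg a.coe_nonneg hc₁) (mul_nonneg b.coe_nonneg hc₂), ENNReal.ofReal_mul a.coe_nonneg,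
      ENNReal.ofReal_mul b.coe_nonneg, ENNReal.ofReal_coe_nnreal, ENNReal.ofReal_coe_nnreal]
    gcongr

/-- Moving each data point `ŵ_l` to one point `w l ∈ Ξ` is a transport plan. -/
lemma mem_achievable_of_points {m : ℕ} {ι : Type*} (nrm : Seminorm ℝ (Vec m)) {Xi : Set (Vec m)}
    {φ : Vec m → EReal} {Γ : Finset ι} (hΓ : Γ.Nonempty) (data : ι → Vec m) {w : ι → Vec m}
    (hw : ∀ l ∈ Γ, w l ∈ Xi) {t : ι → ℝ} (ht : ∀ l ∈ Γ, (t l : EReal) ≤ φ (w l)) :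
    (∑ l ∈ Γ, (Γ.card : ℝ)⁻¹ * nrm (w l - data l), ∑ l ∈ Γ, (Γ.card : ℝ)⁻¹ * t l) ∈
      achievable nrm Xi φ Γ data := by
  have hpos : ∀ l ∈ Γ, 0 ≤ (Γ.card : ℝ)⁻¹ * nrm (w l - data l) := fun l _ =>
    mul_nonneg (by positivity) (apply_nonneg _ _)
  refine ⟨Finset.sum_nonneg hpos, empirical Γ w, ⟨⟨empirical_univ hΓ w⟩, empirical_compl hw⟩, ?_,
    ((Γ.card : ℝ≥0∞))⁻¹ • ∑ l ∈ Γ, Measure.dirac (w l, data l), ⟨?_, ?_⟩, ?_⟩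
  · rw [empirical_eq_sum hΓ]
    have := le_expect_sum_smul (s := Γ) (c := fun _ => (Γ.card : NNReal)⁻¹)
      (P := fun l => Measure.dirac (w l)) (φ := φ) (ρ := t)
      (fun l hl => by rw [expect_dirac]; exact ht l hl)
    simpa using this
  · rw [Measure.map_smul, Measure.map_finset_sum measurable_fst.aemeasurable]
    simp [empirical, Measure.map_dirac' measurable_fst]
  · rw [Measure.map_smul, Measure.map_finset_sum measurable_snd.aemeasurable]
    simp [empirical, Measure.map_dirac' measurable_snd]
  · rw [lintegral_smul_measure, lintegral_finsetSum_measure, ENNReal.ofReal_sum_of_nonneg hpos,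
      smul_eq_mul, Finset.mul_sum]
    refine Finset.sum_le_sum fun l _ => ?_
    rw [lintegral_dirac, ENNReal.ofReal_mul (by positivity), card_inv_coe hΓ]
    refine le_of_eq ?_
    congr 1
    rw [← ENNReal.ofReal_coe_nnreal]
    simp

/-! ### Separation arguments -/

lemma continuous_seminorm {m : ℕ} (nrm : Seminorm ℝ (Vec m)) : Continuous nrm :=
  nrm.convexOn.locallyLipschitz.continuous

lemma exists_norm_le_mul {m : ℕ} (nrm : Seminorm ℝ (Vec m)) (hnrm : ∀ w, nrm w = 0 → w = 0) :
    ∃ C : ℝ, 0 ≤ C ∧ ∀ w, ‖w‖ ≤ C * nrm w := by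
  by_cases hne : (Metric.sphere (0 : Vec m) 1).Nonempty
  · obtain ⟨w₀, hw₀, hmin⟩ := (isCompact_sphere (0 : Vec m) 1).exists_isMinOn hne
      (continuous_seminorm nrm).continuousOn
    have hw₀' : ‖w₀‖ = 1 := by simpa using hw₀
    have hpos : 0 < nrm w₀ := by
      refine lt_of_le_of_ne (apply_nonneg _ _) fun h => ?_
      rw [hnrm w₀ h.symm, norm_zero] at hw₀'
      exact zero_ne_one hw₀'
    refine ⟨(nrm w₀)⁻¹, by positivity, fun w => ?_⟩
    by_cases hw : w = 0
    · simp [hw]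
    have hw' : 0 < ‖w‖ := norm_pos_iff.mpr hw
    have h1 : nrm w₀ ≤ nrm (‖w‖⁻¹ • w) := hmin (by simp [norm_smul, hw'.ne'])
    rw [map_smul_eq_mul, norm_inv, norm_norm, inv_mul_eq_div, le_div_iff₀ hw'] at h1
    rw [inv_mul_eq_div, le_div_iff₀ hpos]
    linarith
  · refine ⟨0, le_rfl, fun w => ?_⟩
    have : w = 0 := by
      by_contra hw
      exact hne ⟨‖w‖⁻¹ • w, by simp [norm_smul, hw]⟩
    simp [this]

lemma clm_prod_apply {m : ℕ} (F : Vec m × ℝ →L[ℝ] ℝ) (w : Vec m) (t : ℝ) :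
    F (w, t) = F (w, 0) + t * F (0, 1) := by
  have : (w, t) = (w, 0) + t • ((0 : Vec m), (1 : ℝ)) := by simp
  rw [this, map_add, map_smul, smul_eq_mul]

/-- A concave upper semicontinuous function without the value `⊤` grows at most linearly: its
closed hypograph is separated from a point above it. -/
lemma exists_linear_growth {m : ℕ} {nrm : Seminorm ℝ (Vec m)} (hnrm : ∀ w, nrm w = 0 → w = 0)
    {Xi : Set (Vec m)} (hXi : IsClosed Xi) {φ : Vec m → EReal}
    (hφ : UpperSemicontinuousOn φ Xi) (hconc : EConcaveOn Xi φ) (htop : ∀ w ∈ Xi, φ w ≠ ⊤) :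
    ∃ a b : ℝ, 0 ≤ b ∧ ∀ w ∈ Xi, φ w ≤ ((a + b * nrm w : ℝ) : EReal) := by
  by_cases hbot : ∀ w ∈ Xi, φ w = ⊥
  · exact ⟨0, 0, le_rfl, fun w hw => by rw [hbot w hw]; exact bot_le⟩
  push Not at hbot
  obtain ⟨w₀, hw₀, hφ₀⟩ := hbot
  have hclosed : IsClosed {p : Vec m × ℝ | p.1 ∈ Xi ∧ (p.2 : EReal) ≤ φ p.1} :=
    ((upperSemicontinuousOn_iff_isClosed_hypograph hXi).mp hφ).preimage
      (f := fun p : Vec m × ℝ => (p.1, (p.2 : EReal)))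
      (continuous_fst.prodMk (continuous_coe_real_ereal.comp continuous_snd))
  have hcoe : ((φ w₀).toReal : EReal) = φ w₀ := EReal.coe_toReal (htop w₀ hw₀) hφ₀
  obtain ⟨F, u, hFu, hu⟩ := geometric_hahn_banach_closed_point hconc hclosed
    (x := (w₀, (φ w₀).toReal + 1)) (by
      rintro ⟨-, h⟩
      simp only at h
      rw [← hcoe, EReal.coe_le_coe_iff, EReal.toReal_coe] at h
      linarith)
  have hs : 0 < F (0, 1) := by
    have h1 := hFu (w₀, (φ w₀).toReal) ⟨hw₀, hcoe.le⟩
    rw [clm_prod_apply] at h1 hu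
    linarith
  set s := F (0, 1) with hs'
  obtain ⟨C, hC, hCn⟩ := exists_norm_le_mul nrm hnrm
  refine ⟨u / s, ‖F‖ * C / s, by positivity, fun w hw => ?_⟩
  by_cases hw' : φ w = ⊥
  · rw [hw']; exact bot_le
  have hcw : ((φ w).toReal : EReal) = φ w := EReal.coe_toReal (htop w hw) hw'
  have h1 := hFu (w, (φ w).toReal) ⟨hw, hcw.le⟩
  rw [clm_prod_apply, ← hs'] at h1
  have h2 : -F (w, 0) ≤ ‖F‖ * (C * nrm w) := by
    refine (neg_le_abs _).trans ((F.le_opNorm _).trans ?_)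
    gcongr
    simpa [Prod.norm_def] using hCn w
  rw [← hcw, EReal.coe_le_coe_iff, div_mul_eq_mul_div, ← add_div, le_div_iff₀ hs]
  linarith

/-- A concave function below the cone `β + λ ‖w - w₀‖` lies below one of the affine functions
`β - ⟨z, w - w₀⟩` with `‖z‖_* ≤ λ`: a hyperplane separates the hypograph from the open cone. -/
lemma exists_dual_vector {m : ℕ} {nrm : Seminorm ℝ (Vec m)} {Xi : Set (Vec m)}
    {φ : Vec m → EReal} (hconc : EConcaveOn Xi φ) {w₀ : Vec m} {lam β : ℝ} (hlam : 0 ≤ lam)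
    (hle : ∀ w ∈ Xi, φ w ≤ ((β + lam * nrm (w - w₀) : ℝ) : EReal)) :
    ∃ z : Vec m, (∀ d, inner ℝ z d ≤ lam * nrm d) ∧
      ∀ w ∈ Xi, φ w ≤ ((β - inner ℝ z (w - w₀) : ℝ) : EReal) := by
  by_cases hbot : ∀ w ∈ Xi, φ w = ⊥
  · refine ⟨0, fun d => ?_, fun w hw => by rw [hbot w hw]; exact bot_le⟩
    rw [inner_zero_left]
    exact mul_nonneg hlam (apply_nonneg _ _)
  push Not at hbot
  obtain ⟨w₁, hw₁, hφ₁⟩ := hbot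
  have htop : ∀ w ∈ Xi, φ w ≠ ⊤ := fun w hw h => by
    have := hle w hw
    rw [h, top_le_iff] at this
    exact EReal.coe_ne_top _ this
  set O : Set (Vec m × ℝ) := {p | β + lam * nrm (p.1 - w₀) < p.2} with hO
  have hOopen : IsOpen O := by
    have := continuous_seminorm nrm
    exact isOpen_lt (by fun_prop) continuous_snd
  have hOconv : Convex ℝ O := by
    rintro ⟨x, s⟩ hx ⟨y, t⟩ hy a b ha hb hab
    simp only [hO, Set.mem_ofPred_eq, Prod.smul_mk, Prod.mk_add_mk, smul_eq_mul] at hx hy ⊢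
    have h1 : nrm (a • x + b • y - w₀) ≤ a * nrm (x - w₀) + b * nrm (y - w₀) := by
      have : a • x + b • y - w₀ = a • (x - w₀) + b • (y - w₀) := by
        have : w₀ = (a + b) • w₀ := by rw [hab, one_smul]
        nth_rw 1 [this]
        module
      rw [this]
      refine (map_add_le_add nrm _ _).trans (le_of_eq ?_)
      rw [map_smul_eq_mul, map_smul_eq_mul, Real.norm_of_nonneg ha, Real.norm_of_nonneg hb]
    have h2 : β + lam * nrm (a • x + b • y - w₀) ≤
        a * (β + lam * nrm (x - w₀)) + b * (β + lam * nrm (y - w₀)) := by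
      have := mul_le_mul_of_nonneg_left h1 hlam
      have hβ : β = (a + b) * β := by rw [hab, one_mul]
      linarith
    refine h2.trans_lt ?_
    rcases ha.eq_or_lt with rfl | ha'
    · have : b = 1 := by linarith
      subst this; linarith
    · have := mul_lt_mul_of_pos_left hx ha'
      have := mul_le_mul_of_nonneg_left hy.le hb
      linarith
  have hdisj : Disjoint O {p : Vec m × ℝ | p.1 ∈ Xi ∧ (p.2 : EReal) ≤ φ p.1} := by
    rw [Set.disjoint_left]
    rintro ⟨w, t⟩ hp ⟨hw, ht⟩
    have := EReal.coe_le_coe_iff.mp (ht.trans (hle w hw))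
    simp only [hO, Set.mem_ofPred_eq] at hp
    linarith
  obtain ⟨F, u, hFO, hFH⟩ := geometric_hahn_banach_open hOconv hOopen hconc hdisj
  replace hFO : ∀ w t, β + lam * nrm (w - w₀) < t → F (w, 0) + t * F (0, 1) < u := fun w t h => by
    rw [← clm_prod_apply]; exact hFO (w, t) h
  have hH : ∀ w ∈ Xi, φ w ≠ ⊥ → u ≤ F (w, 0) + (φ w).toReal * F (0, 1) := fun w hw h => by
    rw [← clm_prod_apply]; exact hFH (w, _) ⟨hw, (EReal.coe_toReal (htop w hw) h).le⟩
  have hs : F (0, 1) < 0 := by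
    have h1 := hH w₁ hw₁ hφ₁
    set T := max (φ w₁).toReal (β + lam * nrm (w₁ - w₀)) + 1
    have h2 := hFO w₁ T (lt_of_le_of_lt (le_max_right _ _) (lt_add_one _))
    have h3 : (φ w₁).toReal < T := lt_of_le_of_lt (le_max_left _ _) (lt_add_one _)
    by_contra! h
    nlinarith
  set s := -F (0, 1) with hs'
  have hs0 : 0 < s := by linarith
  have hF01 : F (0, 1) = -s := by rw [hs']; ring
  rw [hF01] at hH hFO
  -- The functional is bounded on the closed cone too.
  have hcone : ∀ w, F (w, 0) - s * (β + lam * nrm (w - w₀)) ≤ u := fun w => by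
    refine le_of_forall_pos_le_add fun ε hε => ?_
    have := hFO w (β + lam * nrm (w - w₀) + ε / s) (by linarith [div_pos hε hs0])
    have h2 : s * (ε / s) = ε := by field_simp
    linarith
  have hdir : ∀ d, F (d, 0) ≤ s * (lam * nrm d) := fun d => by
    by_contra! hd
    set B := F (d, 0) - s * (lam * nrm d) with hB
    have hB0 : 0 < B := by linarith
    set A := F (w₀, 0) - s * β with hA
    set τ := (|u - A| + 1) / B with hτ
    have hτ0 : 0 < τ := by positivity
    have h1 := hcone (w₀ + τ • d)
    have h2 : F (w₀ + τ • d, 0) = F (w₀, 0) + τ * F (d, 0) := by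
      have : (w₀ + τ • d, (0 : ℝ)) = (w₀, 0) + τ • (d, 0) := by simp
      rw [this, map_add, map_smul, smul_eq_mul]
    rw [h2, add_sub_cancel_left, map_smul_eq_mul, Real.norm_of_nonneg hτ0.le] at h1
    have h3 : τ * B = |u - A| + 1 := by rw [hτ]; field_simp
    have h4 := le_abs_self (u - A)
    have h5 : τ * B = τ * F (d, 0) - τ * (s * (lam * nrm d)) := by rw [hB]; ring
    linarith
  set G : StrongDual ℝ (Vec m) := (-s⁻¹) • F.comp (ContinuousLinearMap.inl ℝ (Vec m) ℝ) with hG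
  have hz : ∀ d, inner ℝ ((InnerProductSpace.toDual ℝ (Vec m)).symm G) d = -s⁻¹ * F (d, 0) := by
    intro d
    rw [InnerProductSpace.toDual_symm_apply]
    simp [hG]
  refine ⟨(InnerProductSpace.toDual ℝ (Vec m)).symm G, fun d => ?_, fun w hw => ?_⟩
  · have h1 := hdir (-d)
    rw [map_neg_eq_map] at h1
    have h2 : F (-d, 0) = -F (d, 0) := by
      rw [← map_neg]; simp
    rw [hz, neg_mul, ← mul_neg, ← h2, inv_mul_le_iff₀ hs0]
    exact h1
  · by_cases hw' : φ w = ⊥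
    · rw [hw']; exact bot_le
    have h1 := hH w hw hw'
    have h2 := hcone w₀
    have h3 : F (w - w₀, 0) = F (w, 0) - F (w₀, 0) := by
      rw [← map_sub]; simp
    rw [sub_self, map_zero, mul_zero, add_zero] at h2
    rw [← EReal.coe_toReal (htop w hw) hw', EReal.coe_le_coe_iff, hz, h3]
    have h4 : β - -s⁻¹ * (F (w, 0) - F (w₀, 0)) = (s * β + (F (w, 0) - F (w₀, 0))) / s := by
      field_simp
      ring
    rw [h4, le_div_iff₀ hs0]
    linarith

/-- Lagrange multiplier for a one-dimensional constraint on a convex set of pairs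
(cost, reward), under Slater's condition. -/
lemma exists_multiplier_of_slater {C : Set (ℝ × ℝ)} (hC : Convex ℝ C) {θ r : ℝ}
    (hle : ∀ p ∈ C, p.1 ≤ θ → p.2 ≤ r) {p₀ : ℝ × ℝ} (hp₀ : p₀ ∈ C) (hslater : p₀.1 < θ) :
    ∃ lam : ℝ, 0 ≤ lam ∧ ∀ p ∈ C, p.2 ≤ r + lam * (p.1 - θ) := by
  have hdisj : Disjoint (Set.Iio θ ×ˢ Set.Ioi r) C := by
    rw [Set.disjoint_left]
    rintro p ⟨h1, h2⟩ hp
    exact absurd (hle p hp (le_of_lt h1)) (not_le.mpr h2)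
  obtain ⟨F, u, hFO, hFC⟩ := geometric_hahn_banach_open
    ((convex_Iio θ).prod (convex_Ioi r)) (isOpen_Iio.prod isOpen_Ioi) hC hdisj
  have happ : ∀ c ρ : ℝ, F (c, ρ) = c * F (1, 0) + ρ * F (0, 1) := fun c ρ => by
    have : (c, ρ) = c • ((1 : ℝ), (0 : ℝ)) + ρ • ((0 : ℝ), (1 : ℝ)) := by simp
    rw [this, map_add, map_smul, map_smul, smul_eq_mul, smul_eq_mul]
  replace hFO : ∀ c ρ, c < θ ∧ r < ρ → c * F (1, 0) + ρ * F (0, 1) < u := fun c ρ h => by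
    rw [← happ]; exact hFO (c, ρ) h
  replace hFC : ∀ c ρ, (c, ρ) ∈ C → u ≤ c * F (1, 0) + ρ * F (0, 1) := fun c ρ h => by
    rw [← happ]; exact hFC (c, ρ) h
  obtain ⟨c₀, ρ₀⟩ := p₀
  have h0 := hFC c₀ ρ₀ hp₀
  set a := F (1, 0)
  set s := F (0, 1)
  simp only at hslater
  have hs : s < 0 := by
    have h1 := hFO c₀ (max r ρ₀ + 1) ⟨hslater, by linarith [le_max_left r ρ₀]⟩
    have h2 := le_max_right r ρ₀
    by_contra! h
    nlinarith
  have ha : 0 ≤ a := by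
    by_contra! h
    have h2 : 0 < (|u - (θ - 1) * a - (r + 1) * s| + 1) / (-a) := by
      apply div_pos <;> [positivity; linarith]
    have h1 := hFO (θ - 1 - (|u - (θ - 1) * a - (r + 1) * s| + 1) / (-a)) (r + 1)
      ⟨by linarith, by linarith⟩
    have h3 : (|u - (θ - 1) * a - (r + 1) * s| + 1) / (-a) * (-a)
        = |u - (θ - 1) * a - (r + 1) * s| + 1 := div_mul_cancel₀ _ (by linarith)
    have h4 := le_abs_self (u - (θ - 1) * a - (r + 1) * s)
    linarith
  have hcl : θ * a + r * s ≤ u := by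
    refine le_of_forall_pos_le_add fun ε hε => ?_
    have hd : 0 < a - s := by linarith
    have h1 := hFO (θ - ε / (a - s)) (r + ε / (a - s))
      ⟨by linarith [div_pos hε hd], by linarith [div_pos hε hd]⟩
    have h2 : ε / (a - s) * (a - s) = ε := by field_simp
    linarith
  refine ⟨a / (-s), div_nonneg ha (by linarith), ?_⟩
  rintro ⟨c, ρ⟩ hp
  have h1 := hFC c ρ hp
  have h2 : r + a / (-s) * (c - θ) = (r * (-s) + a * (c - θ)) / (-s) := by
    have : s ≠ 0 := hs.ne
    field_simp
    ring
  simp only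
  rw [h2, le_div_iff₀ (by linarith)]
  linarith

/-! ### Strong duality for one Wasserstein ball -/

/-- If `φ = ⊥` at points of `Ξ` closer than `d` to `w₀` and `φ < s` at distance at most `d`, then
for large multipliers `φ w - λ (‖w - w₀‖ - d)` is at most `s` on `Ξ`: compactness handles the
points near the sphere of radius `d`, linear growth the others. -/
lemma exists_forall_ge_multiplier {m : ℕ} {nrm : Seminorm ℝ (Vec m)}
    (hnrm : ∀ w, nrm w = 0 → w = 0) {Xi : Set (Vec m)} (hXi : IsClosed Xi) {φ : Vec m → EReal}
    (hφ : UpperSemicontinuousOn φ Xi) {w₀ : Vec m} {a b d s : ℝ}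
    (hgrowth : ∀ w ∈ Xi, φ w ≤ ((a + b * nrm (w - w₀) : ℝ) : EReal))
    (hd : ∀ w ∈ Xi, φ w ≠ ⊥ → d ≤ nrm (w - w₀))
    (hs : ∀ w ∈ Xi, nrm (w - w₀) ≤ d → φ w < (s : EReal)) :
    ∃ L : ℝ, ∀ lam, L ≤ lam → ∀ w ∈ Xi,
      φ w ≤ ((s + lam * (nrm (w - w₀) - d) : ℝ) : EReal) := by
  have hcont : Continuous fun w => nrm (w - w₀) := by
    have := continuous_seminorm nrm
    fun_prop
  have hδ : ∃ δ : ℝ, 0 < δ ∧ ∀ w ∈ Xi, nrm (w - w₀) < d + δ → φ w < (s : EReal) := by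
    obtain ⟨C, hC, hCn⟩ := exists_norm_le_mul nrm hnrm
    have hball : IsCompact {w | nrm (w - w₀) ≤ d + 1} := by
      refine (isCompact_closedBall w₀ (C * (d + 1))).of_isClosed_subset
        (isClosed_le hcont continuous_const) fun w hw => ?_
      rw [Metric.mem_closedBall, dist_eq_norm]
      exact (hCn _).trans (mul_le_mul_of_nonneg_left hw hC)
    have hK : IsCompact ((Xi ∩ {w | nrm (w - w₀) ≤ d + 1}) ∩ φ ⁻¹' Set.Ici (s : EReal)) :=
      (hφ.mono Set.inter_subset_left).isCompact_inter_preimage_Ici (hball.inter_left hXi) _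
    by_cases hne : ((Xi ∩ {w | nrm (w - w₀) ≤ d + 1}) ∩ φ ⁻¹' Set.Ici (s : EReal)).Nonempty
    · obtain ⟨w₁, ⟨⟨hw₁, hw₁'⟩, hs₁⟩, hmin⟩ := hK.exists_isMinOn hne hcont.continuousOn
      refine ⟨nrm (w₁ - w₀) - d, ?_, fun w hw hlt => ?_⟩
      · by_contra! h
        exact absurd (hs w₁ hw₁ (by linarith)) (not_lt.mpr hs₁)
      · by_contra! h
        simp only [Set.mem_ofPred_eq] at hw₁'
        have : nrm (w₁ - w₀) ≤ nrm (w - w₀) :=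
          hmin ⟨⟨hw, by simp only [Set.mem_ofPred_eq]; linarith⟩, h⟩
        linarith
    · refine ⟨1, one_pos, fun w hw hlt => ?_⟩
      by_contra! h
      exact hne ⟨w, ⟨hw, hlt.le⟩, h⟩
  obtain ⟨δ, hδ0, hδ⟩ := hδ
  refine ⟨max 0 (b + max 0 ((a + b * d - s) / δ)), fun lam hlam w hw => ?_⟩
  by_cases hbot : φ w = ⊥
  · rw [hbot]; exact bot_le
  have h0 : 0 ≤ nrm (w - w₀) - d := by linarith [hd w hw hbot]
  have hlam0 : 0 ≤ lam := (le_max_left _ _).trans hlam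
  by_cases hlt : nrm (w - w₀) < d + δ
  · refine (hδ w hw hlt).le.trans (EReal.coe_le_coe_iff.mpr ?_)
    linarith [mul_nonneg hlam0 h0]
  · push Not at hlt
    refine (hgrowth w hw).trans (EReal.coe_le_coe_iff.mpr ?_)
    have h1 : b + max 0 ((a + b * d - s) / δ) ≤ lam := (le_max_right _ _).trans hlam
    have h2 : a + b * d - s ≤ (lam - b) * δ := by
      rw [← div_le_iff₀ hδ0]
      linarith [le_max_right 0 ((a + b * d - s) / δ)]
    have h3 : 0 ≤ lam - b := by linarith [le_max_left 0 ((a + b * d - s) / δ)]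
    have h4 : (lam - b) * δ ≤ (lam - b) * (nrm (w - w₀) - d) :=
      mul_le_mul_of_nonneg_left (by linarith) h3
    linarith

/-- Strong duality for one Wasserstein ball: a bound on the worst-case expectation is certified, up
to an arbitrarily small error, by a multiplier `λ` and values `α l`. With `d l` the distance of
`ŵ_l` to the effective domain of `φ`, Slater's condition holds if `θ` exceeds the mean of the
`d l`; otherwise the certificates arise by letting `λ → ∞`. -/
lemma exists_certificate {m : ℕ} {ι : Type*} {nrm : Seminorm ℝ (Vec m)}
    (hnrm : ∀ w, nrm w = 0 → w = 0) {Xi : Set (Vec m)} (hXi : IsClosed Xi) {φ : Vec m → EReal}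
    (hφ : UpperSemicontinuousOn φ Xi) {a b : ℝ} (hb : 0 ≤ b) {Γ : Finset ι} (hΓ : Γ.Nonempty)
    {data : ι → Vec m}
    (hgrowth : ∀ l ∈ Γ, ∀ w ∈ Xi, φ w ≤ ((a + b * nrm (w - data l) : ℝ) : EReal))
    {θ r r' : ℝ} (hr : r' < r)
    (hV : ∀ Q ∈ wassersteinBall nrm Xi θ (empirical Γ data), expect Q φ ≤ (r' : EReal)) :
    ∃ lam : ℝ, 0 ≤ lam ∧ ∃ α : ι → ℝ,
      (∀ l ∈ Γ, ∀ w ∈ Xi, φ w ≤ ((α l + lam * nrm (w - data l) : ℝ) : EReal)) ∧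
      lam * θ + ∑ l ∈ Γ, α l / (Γ.card : ℝ) ≤ r := by
  have hcard : (0 : ℝ) < Γ.card := by exact_mod_cast hΓ.card_pos
  have hmean : ∀ e : ℝ, ∑ _l ∈ Γ, (Γ.card : ℝ)⁻¹ * e = e := fun e => by
    rw [Finset.sum_const, nsmul_eq_mul]
    field_simp
  have hlin : ∀ (T : ℝ) (u v : ι → ℝ), ∑ l ∈ Γ, (Γ.card : ℝ)⁻¹ * (u l - T * v l) =
      ∑ l ∈ Γ, (Γ.card : ℝ)⁻¹ * u l - T * ∑ l ∈ Γ, (Γ.card : ℝ)⁻¹ * v l := fun T u v => by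
    rw [Finset.mul_sum, ← Finset.sum_sub_distrib]
    exact Finset.sum_congr rfl fun l _ => by ring
  have hach : ∀ c ρ : ℝ, (c, ρ) ∈ achievable nrm Xi φ Γ data → c ≤ θ → ρ ≤ r' := by
    intro c ρ h hc
    obtain ⟨Q, hQ, hρ⟩ := exists_mem_ball_of_achievable h hc
    exact EReal.coe_le_coe_iff.mp (hρ.trans (hV Q hQ))
  simp only [div_eq_inv_mul]
  by_cases hbot : ∀ w ∈ Xi, φ w = ⊥
  · refine ⟨0, le_rfl, fun _ => r, fun l _ w hw => by rw [hbot w hw]; exact bot_le, ?_⟩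
    rw [hmean]
    linarith
  push Not at hbot
  obtain ⟨w₁, hw₁, hφ₁⟩ := hbot
  set d : ι → ℝ := fun l => sInf ((fun w => nrm (w - data l)) '' {w | w ∈ Xi ∧ φ w ≠ ⊥}) with hd
  have hd_le : ∀ l, ∀ w ∈ Xi, φ w ≠ ⊥ → d l ≤ nrm (w - data l) := fun l w hw h =>
    csInf_le ⟨0, by rintro _ ⟨w, -, rfl⟩; exact apply_nonneg _ _⟩ ⟨w, ⟨hw, h⟩, rfl⟩
  rcases lt_trichotomy (∑ l ∈ Γ, (Γ.card : ℝ)⁻¹ * d l) θ with hlt | heq | hgt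
  · -- Slater's condition.
    set e := θ - ∑ l ∈ Γ, (Γ.card : ℝ)⁻¹ * d l with he
    have hw : ∀ l, ∃ w ∈ Xi, φ w ≠ ⊥ ∧ nrm (w - data l) < d l + e := fun l => by
      obtain ⟨_, ⟨w, ⟨hw, hw'⟩, rfl⟩, hlt'⟩ := exists_lt_of_csInf_lt
        (⟨_, w₁, ⟨hw₁, hφ₁⟩, rfl⟩ :
          ((fun w => nrm (w - data l)) '' {w | w ∈ Xi ∧ φ w ≠ ⊥}).Nonempty)
        (show d l < d l + e by linarith)
      exact ⟨w, hw, hw', hlt'⟩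
    choose w hwX hwb hwd using hw
    have hmem := mem_achievable_of_points nrm hΓ data (fun l _ => hwX l)
      (t := fun l => (φ (w l)).toReal) (fun l _ => EReal.coe_toReal_le (hwb l))
    obtain ⟨lam, hlam, hmult⟩ := exists_multiplier_of_slater (achievable_convex nrm Xi φ Γ data)
      (r := r') (fun p hp hpc => hach p.1 p.2 hp hpc) hmem (by
        have : ∑ l ∈ Γ, (Γ.card : ℝ)⁻¹ * nrm (w l - data l) <
            ∑ l ∈ Γ, (Γ.card : ℝ)⁻¹ * (d l + e) := by
          refine Finset.sum_lt_sum_of_nonempty hΓ fun l _ => ?_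
          exact mul_lt_mul_of_pos_left (hwd l) (inv_pos.mpr hcard)
        simp only [mul_add, Finset.sum_add_distrib, hmean] at this
        simp only
        linarith)
    set M : ι → EReal := fun l => ⨆ w ∈ Xi, φ w - ((lam * nrm (w - data l) : ℝ) : EReal) with hM
    have hlt_iff : ∀ l (t : ℝ), (t : EReal) < M l ↔
        ∃ w ∈ Xi, ((t + lam * nrm (w - data l) : ℝ) : EReal) < φ w := by
      intro l t
      simp only [hM, lt_iSup_iff, exists_prop]
      refine exists_congr fun w => and_congr_right fun _ => ?_
      rw [← not_le, sub_coe_le_coe_iff, not_le]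
    have hsum : ∀ t : ι → ℝ, (∀ l ∈ Γ, (t l : EReal) < M l) →
        ∑ l ∈ Γ, (Γ.card : ℝ)⁻¹ * t l ≤ r' - lam * θ := by
      intro t ht
      simp only [hlt_iff] at ht
      choose! w hwX hwt using ht
      have := hmult _ (mem_achievable_of_points nrm hΓ data hwX
        (t := fun l => t l + lam * nrm (w l - data l)) fun l hl => (hwt l hl).le)
      simp only [mul_add, Finset.sum_add_distrib, mul_left_comm _ lam, ← Finset.mul_sum] at this
      rw [← Finset.mul_sum]
      linarith
    have hMbot : ∀ l ∈ Γ, M l ≠ ⊥ := fun l _ => by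
      obtain ⟨t, -, ht⟩ := EReal.lt_iff_exists_real_btwn.mp (bot_lt_iff_ne_bot.mpr hφ₁)
      refine ne_bot_of_gt ((hlt_iff l (t - lam * nrm (w₁ - data l))).mpr ⟨w₁, hw₁, ?_⟩)
      simpa using ht
    have hc : ∀ l ∈ Γ, 0 < (Γ.card : ℝ)⁻¹ := fun l _ => inv_pos.mpr hcard
    obtain ⟨s, hs, hssum⟩ := exists_gt_sum_le hΓ hc (ne_top_of_sum_le hc hMbot hsum)
      (r := r - lam * θ) (by linarith) hsum
    refine ⟨lam, hlam, s, fun l hl w hw => ?_, by linarith⟩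
    by_contra! h
    exact absurd ((hlt_iff l (s l)).mpr ⟨w, hw, h⟩) (not_lt.mpr (hs l hl).le)
  · -- The budget just reaches the effective domain.
    set M : ι → EReal := fun l => ⨆ w ∈ {w | w ∈ Xi ∧ nrm (w - data l) ≤ d l}, φ w with hM
    have hMtop : ∀ l ∈ Γ, M l ≠ ⊤ := fun l hl h => by
      have : M l ≤ ((a + b * d l : ℝ) : EReal) := by
        refine iSup₂_le fun w hw => (hgrowth l hl w hw.1).trans (EReal.coe_le_coe_iff.mpr ?_)
        linarith [mul_le_mul_of_nonneg_left hw.2 hb]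
      rw [h, top_le_iff] at this
      exact EReal.coe_ne_top _ this
    have hsum : ∀ t : ι → ℝ, (∀ l ∈ Γ, (t l : EReal) < M l) →
        ∑ l ∈ Γ, (Γ.card : ℝ)⁻¹ * t l ≤ r' := by
      intro t ht
      simp only [hM, lt_iSup_iff, Set.mem_ofPred_eq, exists_prop] at ht
      choose! w hwX hwt using ht
      refine hach _ _ (mem_achievable_of_points nrm hΓ data (fun l hl => (hwX l hl).1)
        fun l hl => (hwt l hl).le) ?_
      rw [← heq]
      gcongr with l hl
      exact (hwX l hl).2
    obtain ⟨s, hs, hssum⟩ := exists_gt_sum_le hΓ (fun l _ => inv_pos.mpr hcard) hMtop hr hsum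
    have hL : ∀ l ∈ Γ, ∃ L : ℝ, ∀ lam, L ≤ lam → ∀ w ∈ Xi,
        φ w ≤ ((s l + lam * (nrm (w - data l) - d l) : ℝ) : EReal) := fun l hl =>
      exists_forall_ge_multiplier hnrm hXi hφ (hgrowth l hl) (hd_le l) fun w hw hwd =>
        (le_iSup₂ (f := fun w (_ : w ∈ {w | w ∈ Xi ∧ nrm (w - data l) ≤ d l}) => φ w)
          w ⟨hw, hwd⟩).trans_lt (hs l hl)
    choose! L hL using hL
    refine ⟨∑ l ∈ Γ, |L l|, Finset.sum_nonneg fun _ _ => abs_nonneg _,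
      fun l => s l - (∑ l ∈ Γ, |L l|) * d l, fun l hl w hw => ?_, ?_⟩
    · refine (hL l hl (∑ l ∈ Γ, |L l|) ?_ w hw).trans (EReal.coe_le_coe_iff.mpr (le_of_eq (by ring)))
      exact (le_abs_self _).trans
        (Finset.single_le_sum (f := fun l => |L l|) (fun _ _ => abs_nonneg _) hl)
    · rw [hlin, heq]
      linarith
  · -- The effective domain is out of reach: the dual values are unbounded below.
    set e := ∑ l ∈ Γ, (Γ.card : ℝ)⁻¹ * d l - θ with he
    have he0 : 0 < e := by linarith
    set τ := max 0 ((b * θ + a - r) / e) with hτ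
    have hτ0 : 0 ≤ τ := le_max_left _ _
    have hτe : b * θ + a - r ≤ τ * e := by
      rw [← div_le_iff₀ he0]
      exact le_max_right _ _
    refine ⟨b + τ, by linarith, fun l => a - τ * d l, fun l hl w hw => ?_, ?_⟩
    · by_cases hbw : φ w = ⊥
      · rw [hbw]; exact bot_le
      refine (hgrowth l hl w hw).trans (EReal.coe_le_coe_iff.mpr ?_)
      linarith [mul_le_mul_of_nonneg_left (hd_le l w hw hbw) hτ0]
    · rw [hlin, hmean]
      have : τ * e = τ * ∑ l ∈ Γ, (Γ.card : ℝ)⁻¹ * d l - τ * θ := by rw [he]; ring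
      linarith

/-! ### The robust objective as a partial infimum of the finite program -/

lemma le_upperAdd_of_forall {a b c : EReal} (h : ∀ r : ℝ, b < (r : EReal) → c ≤ a + r) :
    c ≤ upperAdd a b := by
  induction a using EReal.rec with
  | top => simp [upperAdd]
  | bot =>
    by_cases hb : b = ⊤
    · simp [upperAdd, hb]
    obtain ⟨r, hr, -⟩ := EReal.lt_iff_exists_real_btwn.mp (lt_top_iff_ne_top.mpr hb)
    have := h r hr
    rw [EReal.bot_add] at this
    exact this.trans bot_le
  | coe a =>
    refine EReal.le_of_forall_lt_iff_le.mp fun z hz => ?_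
    have hb : b < ((z - a : ℝ) : EReal) := by
      by_contra! hb
      refine absurd hz (not_lt.mpr ?_)
      refine le_trans (le_of_eq ?_) (upperAdd_mono_right hb)
      rw [upperAdd_coe]
      norm_cast
      ring
    refine (h _ hb).trans (le_of_eq ?_)
    norm_cast
    ring

/-- The part `∑ k, |Γ_k|/N (λ_k θ_k + ∑ l ∈ Γ_k, α_l/|Γ_k|)` of the objective of the finite
program that does not involve `f`. -/
noncomputable def certCost {N K : ℕ} (label : Fin N → Fin K) (θ : Fin K → ℝ) (lam : Fin K → ℝ)
    (α : Fin N → ℝ) : ℝ :=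
  ∑ k, ((cluster label k).card : ℝ) / (N : ℝ) *
    (lam k * θ k + ∑ l ∈ cluster label k, α l / ((cluster label k).card : ℝ))

lemma cluster_nonempty {N K : ℕ} {label : Fin N → Fin K} (hlabel : Function.Surjective label)
    (k : Fin K) : (cluster label k).Nonempty := by
  obtain ⟨l, hl⟩ := hlabel k
  exact ⟨l, by simp [cluster, hl]⟩

lemma weight_coe {N : ℕ} (hN : 0 < N) (c : ℕ) :
    (c : ℝ≥0∞) / (N : ℝ≥0∞) = (((c : NNReal) / (N : NNReal) : NNReal) : ℝ≥0∞) := by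
  rw [ENNReal.coe_div (by exact_mod_cast hN.ne'), ENNReal.coe_natCast, ENNReal.coe_natCast]

lemma upperSemicontinuousOn_maxLoss {n m I : ℕ} (hI : 0 < I) {Xi : Set (Vec m)}
    {h : Fin I → Vec n → Vec m → EReal} {x : Vec n}
    (husc : ∀ i, UpperSemicontinuousOn (h i x) Xi) : UpperSemicontinuousOn (maxLoss h x) Xi := by
  have : Nonempty (Fin I) := ⟨⟨0, hI⟩⟩
  intro w hw y hy
  have : ∀ i, ∀ᶠ w' in nhdsWithin w Xi, h i x w' < y := fun i =>
    husc i w hw y ((le_iSup (fun i => h i x w) i).trans_lt hy)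
  filter_upwards [Filter.eventually_all.mpr this] with w' hw'
  obtain ⟨i, hi⟩ := exists_eq_ciSup_of_finite (f := fun i => h i x w')
  change ⨆ i, h i x w' < y
  rw [← hi]
  exact hw' i

lemma inner_le_of_forall_le_one {m : ℕ} {nrm : Seminorm ℝ (Vec m)}
    (hnrm : ∀ w, nrm w = 0 → w = 0) {z : Vec m} {lam : ℝ}
    (hz : ∀ w, nrm w ≤ 1 → inner ℝ z w ≤ lam) (d : Vec m) : inner ℝ z d ≤ lam * nrm d := by
  rcases (apply_nonneg nrm d).eq_or_lt with h | h
  · rw [hnrm d h.symm]; simp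
  · have := hz ((nrm d)⁻¹ • d) (by
      rw [map_smul_eq_mul, norm_inv, Real.norm_of_nonneg h.le, inv_mul_cancel₀ h.ne'])
    rwa [real_inner_smul_right, inv_mul_le_iff₀ h, mul_comm] at this

/-- Feasible points of the finite program majorize the loss by cones with vertices at the data. -/
lemma maxLoss_le_of_feasible {n m I N K : ℕ} {nrm : Seminorm ℝ (Vec m)}
    (hnrm : ∀ w, nrm w = 0 → w = 0) {X : Set (Vec n)} {Xi : Set (Vec m)}
    {h : Fin I → Vec n → Vec m → EReal} {data : Fin N → Vec m} {label : Fin N → Fin K}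
    {y : Var n m I N K} (hy : y ∈ progFeasible nrm X Xi h data label) (l : Fin N) :
    ∀ w ∈ Xi, maxLoss h (Var.x y) w ≤
      ((Var.alpha y l + Var.lam y (label l) * nrm (w - data l) : ℝ) : EReal) := by
  intro w hw
  refine iSup_le fun i => ?_
  have h1 := hy.2.2.1 l i
  have h2 := hy.2.2.2 l i
  rw [← EReal.coe_zero, conjConstraint_le_iff] at h1
  rw [← EReal.coe_zero, normConstraint_le_iff] at h2
  obtain ⟨s, hs, hv⟩ := h1
  refine (hs w hw).trans (EReal.coe_le_coe_iff.mpr ?_)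
  have h3 := hv w hw
  have h4 := inner_le_of_forall_le_one hnrm h2 (data l - w)
  rw [map_sub_rev, inner_sub_right] at h4
  rw [inner_sub_left]
  linarith

/-- Weak duality. -/
lemma iSup_expect_le_of_feasible {n m I N K : ℕ} (hN : 0 < N) (hI : 0 < I)
    {nrm : Seminorm ℝ (Vec m)} (hnrm : ∀ w, nrm w = 0 → w = 0) {X : Set (Vec n)}
    {Xi : Set (Vec m)} (hXi : IsClosed Xi) {h : Fin I → Vec n → Vec m → EReal}
    {data : Fin N → Vec m} {label : Fin N → Fin K} (hlabel : Function.Surjective label)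
    {θ : Fin K → ℝ} (hθ : ∀ k, 0 ≤ θ k) {y : Var n m I N K}
    (husc : ∀ i, UpperSemicontinuousOn (h i (Var.x y)) Xi)
    (hy : y ∈ progFeasible nrm X Xi h data label) :
    ⨆ Q ∈ ambiguitySet nrm Xi data label θ, expect Q (maxLoss h (Var.x y)) ≤
      (certCost label θ (Var.lam y) (Var.alpha y) : EReal) := by
  refine iSup₂_le ?_
  rintro _ ⟨P, hP, rfl⟩
  simp only [weight_coe hN]
  refine (expect_sum_smul_le (ρ := fun k => Var.lam y k * θ k +
      ∑ l ∈ cluster label k, Var.alpha y l / ((cluster label k).card : ℝ)) fun k _ =>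
    expect_le_of_mem_wassersteinBall (continuous_seminorm nrm) hXi
      (upperSemicontinuousOn_maxLoss hI husc) (cluster_nonempty hlabel k) (hy.2.1 k) (hθ k)
      (α := Var.alpha y) (fun l hl w hw => ?_) (hP k)).trans (le_of_eq ?_)
  · have hlk : label l = k := by simpa [cluster] using hl
    rw [← hlk]
    exact maxLoss_le_of_feasible hnrm hy l w hw
  · simp [certCost]

/-- Cone majorants of the loss extend to feasible points of the finite program, with `v = 0`. -/
lemma exists_feasible_of_certificate {n m I N K : ℕ} {nrm : Seminorm ℝ (Vec m)}
    {X : Set (Vec n)} {Xi : Set (Vec m)} {h : Fin I → Vec n → Vec m → EReal}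
    {data : Fin N → Vec m} {label : Fin N → Fin K} {x : Vec n} (hx : x ∈ X)
    (hconcave : ∀ i, EConcaveOn Xi (h i x)) {lam : Fin K → ℝ} (hlam : ∀ k, 0 ≤ lam k)
    {α : Fin N → ℝ}
    (hα : ∀ l, ∀ w ∈ Xi, maxLoss h x w ≤ ((α l + lam (label l) * nrm (w - data l) : ℝ) : EReal)) :
    ∃ y ∈ progFeasible nrm X Xi h data label, Var.x y = x ∧ Var.lam y = lam ∧ Var.alpha y = α := by
  have hz : ∀ l i, ∃ z : Vec m, (∀ d, inner ℝ z d ≤ lam (label l) * nrm d) ∧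
      ∀ w ∈ Xi, h i x w ≤ ((α l - inner ℝ z (w - data l) : ℝ) : EReal) := fun l i =>
    exists_dual_vector (hconcave i) (hlam _) fun w hw =>
      (le_iSup (fun i => h i x w) i).trans (hα l w hw)
  choose z hz1 hz2 using hz
  refine ⟨(x, lam, α, z, 0), ⟨hx, hlam, fun l i => ?_, fun l i => ?_⟩, rfl, rfl, rfl⟩
  · rw [← EReal.coe_zero, conjConstraint_le_iff]
    refine ⟨inner ℝ (z l i) (data l) + α l, fun w hw => ?_, fun w _ => ?_⟩
    · refine (hz2 l i w hw).trans (EReal.coe_le_coe_iff.mpr (le_of_eq ?_))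
      simp only [Var.z, Var.v, Pi.zero_apply, sub_zero, inner_sub_right]
      ring
    · simp [Var.v, Var.z, Var.alpha]
  · rw [← EReal.coe_zero, normConstraint_le_iff]
    intro w hw
    refine (hz1 l i w).trans ?_
    rw [zero_add]
    exact mul_le_of_le_one_right (hlam _) hw

lemma exists_linear_growth_maxLoss {n m I N : ℕ} {nrm : Seminorm ℝ (Vec m)}
    (hnrm : ∀ w, nrm w = 0 → w = 0) {Xi : Set (Vec m)} (hXi : IsClosed Xi)
    {h : Fin I → Vec n → Vec m → EReal} {x : Vec n}
    (htop : ∀ i, ∀ w ∈ Xi, h i x w ≠ ⊤) (husc : ∀ i, UpperSemicontinuousOn (h i x) Xi)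
    (hconcave : ∀ i, EConcaveOn Xi (h i x)) (data : Fin N → Vec m) :
    ∃ a b : ℝ, 0 ≤ b ∧
      ∀ l, ∀ w ∈ Xi, maxLoss h x w ≤ ((a + b * nrm (w - data l) : ℝ) : EReal) := by
  choose a b hb hab using fun i =>
    exists_linear_growth hnrm hXi (husc i) (hconcave i) (htop i)
  have hb' : 0 ≤ ∑ i, b i := Finset.sum_nonneg fun i _ => hb i
  refine ⟨∑ i, |a i| + (∑ i, b i) * ∑ l, nrm (data l), ∑ i, b i, hb', fun l w hw => ?_⟩
  refine iSup_le fun i => (hab i w hw).trans (EReal.coe_le_coe_iff.mpr ?_)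
  have h1 : a i ≤ ∑ i, |a i| := (le_abs_self _).trans
    (Finset.single_le_sum (f := fun i => |a i|) (fun _ _ => abs_nonneg _) (Finset.mem_univ i))
  have h2 : b i ≤ ∑ i, b i := Finset.single_le_sum (fun i _ => hb i) (Finset.mem_univ i)
  have h3 : nrm (data l) ≤ ∑ l, nrm (data l) :=
    Finset.single_le_sum (f := fun l => nrm (data l)) (fun _ _ => apply_nonneg _ _)
      (Finset.mem_univ l)
  have h4 : nrm w ≤ nrm (w - data l) + nrm (data l) := by
    simpa using map_add_le_add nrm (w - data l) (data l)
  have h5 : b i * nrm w ≤ (∑ i, b i) * (nrm (w - data l) + ∑ l, nrm (data l)) :=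
    mul_le_mul h2 (by linarith) (apply_nonneg _ _) hb'
  linarith

/-- Strong duality. -/
lemma exists_feasible_of_iSup_expect_lt {n m I N K : ℕ} (hN : 0 < N) (hI : 0 < I)
    {nrm : Seminorm ℝ (Vec m)} (hnrm : ∀ w, nrm w = 0 → w = 0) {X : Set (Vec n)}
    {Xi : Set (Vec m)} (hXi : IsClosed Xi) {h : Fin I → Vec n → Vec m → EReal} {x : Vec n}
    (hx : x ∈ X) (htop : ∀ i, ∀ w ∈ Xi, h i x w ≠ ⊤)
    (husc : ∀ i, UpperSemicontinuousOn (h i x) Xi) (hconcave : ∀ i, EConcaveOn Xi (h i x))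
    {data : Fin N → Vec m} {label : Fin N → Fin K} (hlabel : Function.Surjective label)
    {θ : Fin K → ℝ} (hθ : ∀ k, 0 ≤ θ k) {r : ℝ}
    (hr : ⨆ Q ∈ ambiguitySet nrm Xi data label θ, expect Q (maxLoss h x) < (r : EReal)) :
    ∃ y ∈ progFeasible nrm X Xi h data label, Var.x y = x ∧
      certCost label θ (Var.lam y) (Var.alpha y) ≤ r := by
  obtain ⟨r', hr', hr'r⟩ := EReal.lt_iff_exists_real_btwn.mp hr
  rw [EReal.coe_lt_coe_iff] at hr'r
  have hφ := upperSemicontinuousOn_maxLoss hI husc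
  obtain ⟨a, b, hb, hgrowth⟩ := exists_linear_growth_maxLoss hnrm hXi htop husc hconcave data
  have hne := cluster_nonempty hlabel
  have hN' : (0 : ℝ) < N := by exact_mod_cast hN
  set V : Fin K → EReal := fun k =>
    ⨆ Q ∈ wassersteinBall nrm Xi (θ k) (localEmpirical data label k), expect Q (maxLoss h x) with hV
  have hVtop : ∀ k ∈ Finset.univ, V k ≠ ⊤ := fun k _ hk => by
    have : V k ≤ _ := iSup₂_le fun Q hQ =>
      expect_le_of_mem_wassersteinBall (continuous_seminorm nrm) hXi hφ (hne k) hb (hθ k)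
        (fun l _ => hgrowth l) hQ
    rw [hk, top_le_iff] at this
    exact EReal.coe_ne_top _ this
  have hc : ∀ k ∈ Finset.univ, (0 : ℝ) < ((cluster label k).card : ℝ) / (N : ℝ) := fun k _ =>
    div_pos (by exact_mod_cast (hne k).card_pos) hN'
  obtain ⟨s, hs, hsum⟩ := exists_gt_sum_le ⟨label ⟨0, hN⟩, Finset.mem_univ _⟩ hc hVtop hr'r
    fun t ht => by
      simp only [hV, lt_iSup_iff, exists_prop, Finset.mem_univ, true_imp_iff] at ht
      choose P hP htP using ht
      have h1 := le_expect_sum_smul (s := Finset.univ)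
        (c := fun k => ((cluster label k).card : NNReal) / (N : NNReal)) (P := P)
        fun k _ => (htP k).le
      simp only [← weight_coe hN] at h1
      have h2 := h1.trans ((le_iSup₂ (f := fun Q (_ : Q ∈ ambiguitySet nrm Xi data label θ) =>
        expect Q (maxLoss h x)) _ ⟨P, hP, rfl⟩).trans hr'.le)
      simpa using h2
  have hcert : ∀ k, ∃ lam : ℝ, 0 ≤ lam ∧ ∃ α : Fin N → ℝ,
      (∀ l ∈ cluster label k, ∀ w ∈ Xi,
        maxLoss h x w ≤ ((α l + lam * nrm (w - data l) : ℝ) : EReal)) ∧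
      lam * θ k + ∑ l ∈ cluster label k, α l / ((cluster label k).card : ℝ) ≤ s k := fun k => by
    obtain ⟨s', hs', hs's⟩ := EReal.lt_iff_exists_real_btwn.mp (hs k (Finset.mem_univ k))
    exact exists_certificate hnrm hXi hφ hb (hne k) (fun l _ => hgrowth l)
      (EReal.coe_lt_coe_iff.mp hs's) fun Q hQ => (le_iSup₂ (f := fun Q
        (_ : Q ∈ wassersteinBall nrm Xi (θ k) (localEmpirical data label k)) =>
          expect Q (maxLoss h x)) Q hQ).trans hs'.le
  choose lam hlam α hα hcost using hcert
  obtain ⟨y, hy, hyx, hyl, hya⟩ := exists_feasible_of_certificate (nrm := nrm) (data := data)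
    (label := label) hx hconcave hlam (α := fun l => α (label l) l)
    fun l w hw => hα (label l) l (by simp [cluster]) w hw
  refine ⟨y, hy, hyx, le_trans ?_ hsum⟩
  rw [hyl, hya, certCost]
  refine Finset.sum_le_sum fun k hk => mul_le_mul_of_nonneg_left ?_ (hc k hk).le
  refine le_trans (le_of_eq ?_) (hcost k)
  congr 1
  refine Finset.sum_congr rfl fun l hl => ?_
  have hlk : label l = k := by simpa [cluster] using hl
  rw [hlk]

end BNWDRO

theorem theorem5 {n m I N K : ℕ} (hN : 0 < N) (hI : 0 < I)
    -- an arbitrary norm on `ℝ^m`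
    (nrm : Seminorm ℝ (BNWDRO.Vec m)) (hnrm : ∀ w, nrm w = 0 → w = 0)
    -- feasible region and support: convex and closed
    (X : Set (BNWDRO.Vec n)) (hXconv : Convex ℝ X) (hXclosed : IsClosed X)
    (Xi : Set (BNWDRO.Vec m)) (hXiconv : Convex ℝ Xi) (hXiclosed : IsClosed Xi)
    -- data in the support, partitioned into `K` nonempty clusters, and the local radii
    (data : Fin N → BNWDRO.Vec m) (hdata : ∀ l, data l ∈ Xi)
    (label : Fin N → Fin K) (hlabel : Function.Surjective label)
    (θ : Fin K → ℝ) (hθ : ∀ k, 0 ≤ θ k)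
    -- `f` is convex
    (f : BNWDRO.Vec n → EReal) (hf : BNWDRO.EConvexOn X f)
    -- each `h i` is proper, upper semicontinuous and concave in `w`, and convex in `x`
    (h : Fin I → BNWDRO.Vec n → BNWDRO.Vec m → EReal)
    (hproper : ∀ i, (∀ x ∈ X, ∀ w ∈ Xi, h i x w ≠ ⊤) ∧ ∃ x ∈ X, ∃ w ∈ Xi, h i x w ≠ ⊥)
    (husc : ∀ i, ∀ x ∈ X, UpperSemicontinuousOn (h i x) Xi)
    (hconvex : ∀ i, ∀ w ∈ Xi, BNWDRO.EConvexOn X (fun x => h i x w))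
    (hconcave : ∀ i, ∀ x ∈ X, BNWDRO.EConcaveOn Xi (h i x)) :
    let J : BNWDRO.Vec n → EReal := BNWDRO.robustObjective nrm Xi f h data label θ
    let F : BNWDRO.Var n m I N K → EReal := BNWDRO.progObjective f label θ
    let S : Set (BNWDRO.Var n m I N K) := BNWDRO.progFeasible nrm X Xi h data label
    let D : Set (BNWDRO.Var n m I N K) := {y | BNWDRO.Var.x y ∈ X}
    -- the finite program is convex
    (BNWDRO.EConvexOn D F ∧
      (∀ l i, BNWDRO.EConvexOn D (BNWDRO.conjConstraint Xi h data l i)) ∧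
      (∀ l i, BNWDRO.EConvexOn D (BNWDRO.normConstraint nrm label l i)) ∧
      Convex ℝ S) ∧
    -- for every decision, the robust objective is the partial infimum of the finite program
    (∀ x ∈ X, J x = ⨅ y ∈ {y ∈ S | BNWDRO.Var.x y = x}, F y) ∧
    -- the optimal values agree
    (⨅ x ∈ X, J x) = (⨅ y ∈ S, F y) ∧
    -- a feasible point is optimal iff its decision solves the robust problem and the remaining
    -- variables attain the robust objective there
    (∀ y ∈ S, (∀ y' ∈ S, F y ≤ F y') ↔
      ((∀ x ∈ X, J (BNWDRO.Var.x y) ≤ J x) ∧ F y = J (BNWDRO.Var.x y))) := by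
  intro J F S D
  have hJ : ∀ x ∈ X, J x = ⨅ y ∈ {y ∈ S | BNWDRO.Var.x y = x}, F y := by
    intro x hx
    refine le_antisymm (le_iInf₂ ?_) (BNWDRO.le_upperAdd_of_forall fun r hr => ?_)
    · rintro y ⟨hy, rfl⟩
      refine (BNWDRO.upperAdd_mono_right (BNWDRO.iSup_expect_le_of_feasible hN hI hnrm hXiclosed
        hlabel hθ (fun i => husc i _ hx) hy)).trans (le_of_eq ?_)
      rw [BNWDRO.upperAdd_coe]
      rfl
    · obtain ⟨y, hy, rfl, hyr⟩ := BNWDRO.exists_feasible_of_iSup_expect_lt hN hI hnrm hXiclosed hx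
        (fun i => (hproper i).1 x hx) (fun i => husc i x hx) (fun i => hconcave i x hx) hlabel hθ hr
      refine (iInf₂_le y ⟨hy, rfl⟩).trans ?_
      exact add_le_add le_rfl (EReal.coe_le_coe_iff.mpr hyr)
  have hle : ∀ y ∈ S, J (BNWDRO.Var.x y) ≤ F y := fun y hy => by
    rw [hJ _ hy.1]
    exact iInf₂_le y ⟨hy, rfl⟩
  have hval : (⨅ x ∈ X, J x) = ⨅ y ∈ S, F y := by
    refine le_antisymm (le_iInf₂ fun y hy => (iInf₂_le _ hy.1).trans (hle y hy))
      (le_iInf₂ fun x hx => ?_)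
    rw [hJ x hx]
    exact le_iInf₂ fun y hy => iInf₂_le y hy.1
  refine ⟨⟨BNWDRO.progObjective_convexOn hf label θ,
    fun l i => BNWDRO.conjConstraint_convexOn hXconv (hconvex i) data l,
    fun l i => BNWDRO.normConstraint_convexOn hXconv nrm label l i,
    BNWDRO.progFeasible_convex hXconv hconvex nrm data label⟩, hJ, hval, fun y hy => ⟨?_, ?_⟩⟩
  · intro hopt
    have hF : F y ≤ ⨅ x ∈ X, J x := by
      rw [hval]
      exact le_iInf₂ hopt
    exact ⟨fun x hx => (hle y hy).trans (hF.trans (iInf₂_le x hx)),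
      le_antisymm (hF.trans (iInf₂_le _ hy.1)) (hle y hy)⟩
  · rintro ⟨hopt, hFy⟩ y' hy'
    rw [hFy]
    exact (hopt _ hy'.1).trans (hle y' hy')
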